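/- **Proposition 2.1.** Let $a\in C^2(\mathbb R)$ satisfy, for some constants $M,\rho,\kappa>0$, $|a'(s)|\le M$, $|a''(s)|\le M$ and $\rho\le a(s)\le\kappa$ for all $s\in\mathbb R$. Let $T>0$, $Q_T=(0,1)\times(0,T)$ and $y_0\in H^1_0(0,1)$. Let $W^{2,1}_2(Q_T)$ be the space of $y\in L^2(Q_T)$ whose weak derivatives $y_x,y_{xx},y_t$ are in $L^2(Q_T)$, with the norm $\|y\|_{L^2(Q_T)}+\|y_x\|_{L^2(Q_T)}+\|y_{xx}\|_{L^2(Q_T)}+\|y_t\|_{L^2(Q_T)}$, and let $\overset{\circ}{W}{}^{2,1}_2(Q_T)$ be the closure in $W^{2,1}_2(Q_T)$ of the functions that are infinitely differentiable on $\overline Q_T$ and vanish on the lateral boundary $\{0,1\}\times[0,T]$. Let $y\in\overset{\circ}{W}{}^{2,1}_2(Q_T)$ be a solution of $$y_t-(a(y)y_x)_x=0\ \text{ in }Q_T,\qquad y(0,t)=y(1,t)=0\ \ (0<t<T),\qquad y(x,0)=y_0(x)\ \ (0<x<1),$$ where the equation means that $y_t$ is the weak $x$-derivative of $a(y)y_x$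 in $Q_T$, the lateral condition is the membership $y\in\overset{\circ}{W}{}^{2,1}_2(Q_T)$, and the initial condition means that $\operatorname{ess\,lim}_{t\to0^+}\|y(\cdot,t)-y_0\|_{L^2(0,1)}=0$. Then $y$ has a representative that is continuous on $\overline Q_T=[0,1]\times[0,T]$, and this representative, still denoted by $y$, satisfies $$\max_{x\in[0,1]}|y(x,t)|\le(2\rho)^{-1/2}\,\|y_0\|_{L^2(0,1)}\,t^{-1/2}\qquad\text{for all }t\in(0,T].$$ -/

import Mathlib

open Set Filter Topology MeasureTheory
open scoped ENNReal ContDiff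

namespace QuasilinearParabolic

/-- The unit interval `(0,1)` carrying Lebesgue measure. -/
noncomputable def intervalMeasure : Measure ℝ :=
  volume.restrict (Ioo (0 : ℝ) 1)

/-- The space-time cylinder `Q_T = (0,1) × (0,T)`; points are written `(x,t)`. -/
def cylinder (T : ℝ) : Set (ℝ × ℝ) := Ioo (0 : ℝ) 1 ×ˢ Ioo (0 : ℝ) T

/-- Lebesgue measure on `Q_T`. -/
noncomputable def cylinderMeasure (T : ℝ) : Measure (ℝ × ℝ) :=
  volume.restrict (cylinder T)

/-- The classical partial derivative in the space variable. -/
noncomputable def dx (φ : ℝ × ℝ → ℝ) (p : ℝ × ℝ) : ℝ := fderiv ℝ φ p (1, 0)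

/-- The classical partial derivative in the time variable. -/
noncomputable def dt (φ : ℝ × ℝ → ℝ) (p : ℝ × ℝ) : ℝ := fderiv ℝ φ p (0, 1)

/-- `φ ∈ C_c^∞(Ω)`. -/
structure IsTest {E : Type*} [NormedAddCommGroup E] [NormedSpace ℝ E]
    (Ω : Set E) (φ : E → ℝ) : Prop where
  smooth : ContDiff ℝ ∞ φ
  compact : HasCompactSupport φ
  support_subset : tsupport φ ⊆ Ω

/-- `g` is the weak derivative of `f` on `(0,1)`. -/
def IsWeakDeriv (f g : ℝ → ℝ) : Prop :=
  ∀ φ : ℝ → ℝ, IsTest (Ioo (0 : ℝ) 1) φ →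
    ∫ x, f x * deriv φ x ∂intervalMeasure = - ∫ x, g x * φ x ∂intervalMeasure

/-- `v` is the weak derivative of `u` with respect to `x` on `Q_T`. -/
def IsWeakDx (T : ℝ) (u v : ℝ × ℝ → ℝ) : Prop :=
  ∀ φ : ℝ × ℝ → ℝ, IsTest (cylinder T) φ →
    ∫ p, u p * dx φ p ∂cylinderMeasure T = - ∫ p, v p * φ p ∂cylinderMeasure T

/-- `v` is the weak derivative of `u` with respect to `t` on `Q_T`. -/
def IsWeakDt (T : ℝ) (u v : ℝ × ℝ → ℝ) : Prop :=
  ∀ φ : ℝ × ℝ → ℝ, IsTest (cylinder T) φ →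
    ∫ p, u p * dt φ p ∂cylinderMeasure T = - ∫ p, v p * φ p ∂cylinderMeasure T

/-- `f ∈ H¹₀(0,1)`: `f` has a weak derivative, both are in `L²(0,1)`, and `f` is in the
closure of `C_c^∞(0,1)` for the `H¹` norm. -/
def MemH10 (f : ℝ → ℝ) : Prop :=
  ∃ g : ℝ → ℝ, MemLp f 2 intervalMeasure ∧ MemLp g 2 intervalMeasure ∧ IsWeakDeriv f g ∧
    ∃ φ : ℕ → ℝ → ℝ, (∀ n, IsTest (Ioo (0 : ℝ) 1) (φ n)) ∧
      Tendsto (fun n => eLpNorm (fun x => φ n x - f x) 2 intervalMeasure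
        + eLpNorm (fun x => deriv (φ n) x - g x) 2 intervalMeasure) atTop (𝓝 0)

/-- `y ∈ W^{2,1}_2(Q_T)`, with weak derivatives `y_x = yx`, `y_xx = yxx`, `y_t = yt`. -/
structure IsW21 (T : ℝ) (y yx yxx yt : ℝ × ℝ → ℝ) : Prop where
  memLp : MemLp y 2 (cylinderMeasure T)
  memLp_x : MemLp yx 2 (cylinderMeasure T)
  memLp_xx : MemLp yxx 2 (cylinderMeasure T)
  memLp_t : MemLp yt 2 (cylinderMeasure T)
  weak_x : IsWeakDx T y yx
  weak_xx : IsWeakDx T yx yxx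
  weak_t : IsWeakDt T y yt

/-- `y` belongs to `W^{2,1}_2(Q_T)` (with the weak derivatives indicated) and to the closure,
for the `W^{2,1}_2(Q_T)` norm, of the smooth functions on the closed cylinder that vanish on
the lateral boundary `{0,1} × [0,T]`. -/
structure IsW21Zero (T : ℝ) (y yx yxx yt : ℝ × ℝ → ℝ) : Prop where
  isW21 : IsW21 T y yx yxx yt
  approx : ∃ φ : ℕ → ℝ × ℝ → ℝ,
    (∀ n, ContDiff ℝ ∞ (φ n)) ∧
    (∀ n, ∀ t ∈ Icc 0 T, φ n (0, t) = 0 ∧ φ n (1, t) = 0) ∧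
    Tendsto (fun n =>
      eLpNorm (fun p => φ n p - y p) 2 (cylinderMeasure T)
        + eLpNorm (fun p => dx (φ n) p - yx p) 2 (cylinderMeasure T)
        + eLpNorm (fun p => dx (dx (φ n)) p - yxx p) 2 (cylinderMeasure T)
        + eLpNorm (fun p => dt (φ n) p - yt p) 2 (cylinderMeasure T)) atTop (𝓝 0)

/-- `y(·,0) = y₀`: `y(·,t) → y₀` in `L²(0,1)` as `t → 0+`, as an essential limit, so that the
condition does not depend on the representative of `y`. -/
def HasInitialValue (y : ℝ × ℝ → ℝ) (y₀ : ℝ → ℝ) : Prop :=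
  Tendsto (fun t : ℝ => eLpNorm (fun x => y (x, t) - y₀ x) 2 intervalMeasure)
    (𝓝[>] (0 : ℝ) ⊓ ae volume) (𝓝 0)

/-- `y` is a solution of class `W^{2,1}_2(Q_T)` of `y_t = (a(y) y_x)_x` in `Q_T` with
`y(0,t) = y(1,t) = 0` and `y(x,0) = y₀(x)`. The equation says that the weak `x`-derivative of
the flux `a(y) y_x` is `y_t`; the lateral condition is part of the function space. -/
def IsSolution (a : ℝ → ℝ) (T : ℝ) (y₀ : ℝ → ℝ) (y : ℝ × ℝ → ℝ) : Prop :=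
  ∃ yx yxx yt : ℝ × ℝ → ℝ, IsW21Zero T y yx yxx yt ∧
    IsWeakDx T (fun p => a (y p) * yx p) yt ∧ HasInitialValue y y₀

end QuasilinearParabolic

namespace QuasilinearParabolic

/-! Let `m = |Y (x, t)|`. By the maximum principle the spatial maximum of `|Y|` does not increase,
so it is at least `m` at every time in `[0, t]`. A function vanishing at `0` satisfies `f(x)² ≤ ∫
f'²` on `[0,1]`, hence `∫ Y_x² ≥ m²` at each of these times. The energy identity, obtained by
multiplying the equation by `2Y`, then gives `2ρ t m² ≤ ∫ Y(·,0)²`, which is the claim.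

To justify this for a weak solution, everything is done on the smooth approximants `φ n` from the
definition of the closure. An embedding inequality (`sq_le_of_vanishesLaterally`) makes them
converge uniformly, which produces the continuous `Y` (`exists_uniform_limit`). They satisfy the
equation up to a `residual` that tends to `0` in `L¹` (`IsSolution.exists_isApproxSolution`). Since
the multipliers `g (φ n)` are uniformly bounded, `L¹` smallness is enough: `energy_le` holds with an
error that vanishes in the limit. Two choices of multiplier give the maximum principle
(`abs_le_of_abs_le`) and the smoothing estimate (`mul_sq_le`). Finally `HasInitialValue.ae_eq`
identifies `Y(·,0)` with `y₀`. -/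

/-! ### Partial derivatives and iterated integrals on rectangles -/

lemma contDiff_dx {φ : ℝ × ℝ → ℝ} (hφ : ContDiff ℝ ∞ φ) : ContDiff ℝ ∞ (dx φ) :=
  (hφ.fderiv_right (m := ∞) (by simp)).clm_apply contDiff_const

lemma contDiff_dt {φ : ℝ × ℝ → ℝ} (hφ : ContDiff ℝ ∞ φ) : ContDiff ℝ ∞ (dt φ) :=
  (hφ.fderiv_right (m := ∞) (by simp)).clm_apply contDiff_const

lemma hasDerivAt_fst {φ : ℝ × ℝ → ℝ} (hφ : Differentiable ℝ φ) (x t : ℝ) :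
    HasDerivAt (fun x => φ (x, t)) (dx φ (x, t)) x :=
  (hφ (x, t)).hasFDerivAt.comp_hasDerivAt x ((hasDerivAt_id x).prodMk (hasDerivAt_const x t))

lemma hasDerivAt_snd {φ : ℝ × ℝ → ℝ} (hφ : Differentiable ℝ φ) (x t : ℝ) :
    HasDerivAt (fun t => φ (x, t)) (dt φ (x, t)) t :=
  (hφ (x, t)).hasFDerivAt.comp_hasDerivAt t ((hasDerivAt_const t x).prodMk (hasDerivAt_id t))

lemma dx_sub {φ ψ : ℝ × ℝ → ℝ} (hφ : Differentiable ℝ φ) (hψ : Differentiable ℝ ψ) :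
    dx (φ - ψ) = dx φ - dx ψ := by
  ext p
  simp only [dx, Pi.sub_apply]
  rw [fderiv_sub (hφ p) (hψ p)]
  rfl

lemma dt_sub {φ ψ : ℝ × ℝ → ℝ} (hφ : Differentiable ℝ φ) (hψ : Differentiable ℝ ψ) :
    dt (φ - ψ) = dt φ - dt ψ := by
  ext p
  simp only [dt, Pi.sub_apply]
  rw [fderiv_sub (hφ p) (hψ p)]
  rfl

lemma dt_dx_comm {φ : ℝ × ℝ → ℝ} (hφ : ContDiff ℝ ∞ φ) : dt (dx φ) = dx (dt φ) := by
  ext p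
  have hd : DifferentiableAt ℝ (fderiv ℝ φ) p :=
    (hφ.fderiv_right (m := ∞) (by simp)).differentiable (by simp) p
  have hs := (hφ.contDiffAt (x := p)).isSymmSndFDerivAt (by
    simp only [minSmoothness_of_isRCLikeNormedField]; exact WithTop.coe_le_coe.2 le_top)
  have h1 : ∀ v w : ℝ × ℝ, fderiv ℝ (fun q => fderiv ℝ φ q v) p w
      = fderiv ℝ (fderiv ℝ φ) p w v := by
    intro v w
    rw [fderiv_clm_apply hd (differentiableAt_const v)]
    simp
  change fderiv ℝ (fun q => fderiv ℝ φ q (1, 0)) p (0, 1)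
    = fderiv ℝ (fun q => fderiv ℝ φ q (0, 1)) p (1, 0)
  rw [h1, h1]
  exact hs _ _

lemma integrableOn_of_continuous {f : ℝ × ℝ → ℝ} (hf : Continuous f) (a b c d : ℝ) :
    IntegrableOn f (Icc a b ×ˢ Icc c d) :=
  hf.continuousOn.integrableOn_compact (isCompact_Icc.prod isCompact_Icc)

instance (T : ℝ) : IsFiniteMeasure (cylinderMeasure T) := by
  constructor
  rw [cylinderMeasure, Measure.restrict_apply_univ, cylinder, Measure.volume_eq_prod,
    Measure.prod_prod]
  simp

lemma cylinder_subset (T : ℝ) : cylinder T ⊆ Icc (0 : ℝ) 1 ×ˢ Icc (0 : ℝ) T :=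
  Set.prod_mono Ioo_subset_Icc_self Ioo_subset_Icc_self

lemma isOpen_cylinder (T : ℝ) : IsOpen (cylinder T) := isOpen_Ioo.prod isOpen_Ioo

lemma integrable_of_continuous {f : ℝ × ℝ → ℝ} (hf : Continuous f) (T : ℝ) :
    Integrable f (cylinderMeasure T) :=
  (integrableOn_of_continuous hf 0 1 0 T).mono_set (cylinder_subset T)

lemma memLp_two_of_continuous {f : ℝ × ℝ → ℝ} (hf : Continuous f) (T : ℝ) :
    MemLp f 2 (cylinderMeasure T) :=
  (memLp_two_iff_integrable_sq hf.aestronglyMeasurable).2 (integrable_of_continuous (hf.pow 2) T)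

lemma ae_mem_cylinder (T : ℝ) : ∀ᵐ p ∂cylinderMeasure T, p ∈ cylinder T :=
  ae_restrict_mem (isOpen_cylinder T).measurableSet

lemma setIntegral_rect {f : ℝ × ℝ → ℝ} (hf : Continuous f) {s t : ℝ} (hst : s ≤ t) :
    ∫ p in Ioo (0 : ℝ) 1 ×ˢ Ioo s t, f p = ∫ τ in s..t, ∫ x in (0 : ℝ)..1, f (x, τ) := by
  have hi : IntegrableOn f (Ioo (0 : ℝ) 1 ×ˢ Ioo s t) :=
    (integrableOn_of_continuous hf 0 1 s t).mono_set
      (Set.prod_mono Ioo_subset_Icc_self Ioo_subset_Icc_self)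
  rw [intervalIntegral.integral_of_le hst, ← integral_Ioc_eq_integral_Ioo.symm]
  simp_rw [intervalIntegral.integral_of_le zero_le_one, integral_Ioc_eq_integral_Ioo]
  -- Points are `(x, t)` but time is the outer variable of integration, so the factors are exchanged
  -- before Fubini.
  have hsw := setIntegral_prod_swap (μ := (volume : Measure ℝ)) (ν := (volume : Measure ℝ))
    (Ioo (0 : ℝ) 1) (Ioo s t) f
  rw [Measure.volume_eq_prod, ← hsw, setIntegral_prod]
  · rfl
  · exact hi.swap

lemma intervalIntegral_le_cylinder {f : ℝ × ℝ → ℝ} (hf : Continuous f) (h0 : ∀ p, 0 ≤ f p)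
    {s t T : ℝ} (hs : 0 ≤ s) (hst : s ≤ t) (ht : t ≤ T) :
    ∫ τ in s..t, ∫ x in (0 : ℝ)..1, f (x, τ) ≤ ∫ p, f p ∂cylinderMeasure T := by
  rw [← setIntegral_rect hf hst]
  exact setIntegral_mono_set (integrable_of_continuous hf T) (ae_of_all _ h0)
    (Set.prod_mono subset_rfl (Ioo_subset_Ioo hs ht)).eventuallyLE

lemma continuous_sliceIntegral {f : ℝ × ℝ → ℝ} (hf : Continuous f) :
    Continuous fun τ => ∫ x in (0 : ℝ)..1, f (x, τ) :=
  intervalIntegral.continuous_parametric_intervalIntegral_of_continuous'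
    (f := fun τ x => f (x, τ)) (hf.comp continuous_swap) 0 1

/-- The change in time of a slice integral is the integral of the time derivative. -/
lemma sliceIntegral_sub {F Ft : ℝ × ℝ → ℝ} (hF : Continuous F) (hFt : Continuous Ft)
    (hd : ∀ x t, HasDerivAt (fun t => F (x, t)) (Ft (x, t)) t) (s t : ℝ) :
    (∫ x in (0 : ℝ)..1, F (x, t)) - ∫ x in (0 : ℝ)..1, F (x, s)
      = ∫ τ in s..t, ∫ x in (0 : ℝ)..1, Ft (x, τ) := by
  rw [← intervalIntegral.integral_sub
    (Continuous.intervalIntegrable (by fun_prop) _ _)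
    (Continuous.intervalIntegrable (by fun_prop) _ _),
    intervalIntegral_intervalIntegral_swap (F := fun τ x => Ft (x, τ))]
  · refine intervalIntegral.integral_congr fun x _ => ?_
    exact (intervalIntegral.integral_eq_sub_of_hasDerivAt (fun τ _ => hd x τ)
      ((hFt.comp (by fun_prop : Continuous fun τ : ℝ => (x, τ))).intervalIntegrable _ _)).symm
  · have h : Continuous (Function.uncurry fun τ x => Ft (x, τ)) := hFt.comp continuous_swap
    exact (h.continuousOn.integrableOn_compact (isCompact_uIcc.prod isCompact_uIcc)).mono_set
      (Set.prod_mono uIoc_subset_uIcc uIoc_subset_uIcc)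

/-! ### Lateral boundary values and the sup bound for smooth functions -/

/-- `φ` vanishes on the lateral boundary of the cylinder. -/
def VanishesLaterally (T : ℝ) (φ : ℝ × ℝ → ℝ) : Prop :=
  ∀ t ∈ Icc 0 T, φ (0, t) = 0 ∧ φ (1, t) = 0

/-- On each lateral side `φ` is constant in time near an interior `t`. The endpoints are excluded
because nothing is known about `φ` outside `[0, T]`. -/
lemma VanishesLaterally.dt_eq_zero {T : ℝ} {φ : ℝ × ℝ → ℝ} (hb : VanishesLaterally T φ)
    (hφ : Differentiable ℝ φ) {t : ℝ} (ht : t ∈ Ioo 0 T) : dt φ (0, t) = 0 ∧ dt φ (1, t) = 0 := by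
  have hn : Icc 0 T ∈ 𝓝 t := Icc_mem_nhds ht.1 ht.2
  constructor
  · refine (hasDerivAt_snd hφ 0 t).unique ((hasDerivAt_const t (0 : ℝ)).congr_of_eventuallyEq ?_)
    filter_upwards [hn] with τ hτ using (hb τ hτ).1
  · refine (hasDerivAt_snd hφ 1 t).unique ((hasDerivAt_const t (0 : ℝ)).congr_of_eventuallyEq ?_)
    filter_upwards [hn] with τ hτ using (hb τ hτ).2

/-- Integration by parts in space on a rectangle. -/
lemma integral_parts {u v ux vx : ℝ × ℝ → ℝ} (hux : Continuous ux) (hvx : Continuous vx)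
    (hu : ∀ x t, HasDerivAt (fun x => u (x, t)) (ux (x, t)) x)
    (hv : ∀ x t, HasDerivAt (fun x => v (x, t)) (vx (x, t)) x) {s t : ℝ} (hst : s ≤ t)
    (hb : ∀ τ ∈ Ioo s t, v (0, τ) = 0 ∧ v (1, τ) = 0) :
    ∫ τ in s..t, ∫ x in (0 : ℝ)..1, u (x, τ) * vx (x, τ)
      = - ∫ τ in s..t, ∫ x in (0 : ℝ)..1, ux (x, τ) * v (x, τ) := by
  rw [← intervalIntegral.integral_neg, intervalIntegral.integral_of_le hst,
    intervalIntegral.integral_of_le hst, integral_Ioc_eq_integral_Ioo, integral_Ioc_eq_integral_Ioo]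
  refine setIntegral_congr_fun measurableSet_Ioo fun τ hτ => ?_
  have := intervalIntegral.integral_mul_deriv_eq_deriv_mul (a := 0) (b := 1)
    (fun x _ => hu x τ) (fun x _ => hv x τ)
    ((hux.comp (by fun_prop : Continuous fun x : ℝ => (x, τ))).intervalIntegrable _ _)
    ((hvx.comp (by fun_prop : Continuous fun x : ℝ => (x, τ))).intervalIntegrable _ _)
  simp only [this, (hb τ hτ).1, (hb τ hτ).2]
  ring

/-- A function vanishing at `0` is bounded on `[0,1]` by the `L²` norm of its derivative. -/
lemma sq_le_integral_deriv_sq {f g : ℝ → ℝ} (hg : Continuous g)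
    (hf : ∀ x, HasDerivAt f (g x) x) (h0 : f 0 = 0) {x : ℝ} (hx : x ∈ Icc (0 : ℝ) 1) :
    f x ^ 2 ≤ ∫ z in (0 : ℝ)..1, g z ^ 2 := by
  have hI : ∫ z in (0 : ℝ)..x, g z = f x := by
    rw [intervalIntegral.integral_eq_sub_of_hasDerivAt (fun z _ => hf z)
      (hg.intervalIntegrable _ _), h0, sub_zero]
  -- This replaces Cauchy–Schwarz: expanding the square gives `(2 - x) f(x)² ≤ ∫₀ˣ g²`, and `2 - x ≥
  -- 1`.
  have h1 : 0 ≤ ∫ z in (0 : ℝ)..x, (g z - f x) ^ 2 :=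
    intervalIntegral.integral_nonneg hx.1 fun z _ => sq_nonneg _
  have h2 : ∫ z in (0 : ℝ)..x, (g z - f x) ^ 2
      = (∫ z in (0 : ℝ)..x, g z ^ 2) - 2 * f x * f x + x * f x ^ 2 := by
    have : ∀ z, (g z - f x) ^ 2 = g z ^ 2 - 2 * f x * g z + f x ^ 2 := fun z => by ring
    simp_rw [this]
    rw [intervalIntegral.integral_add, intervalIntegral.integral_sub,
      intervalIntegral.integral_const_mul, hI, intervalIntegral.integral_const]
    · simp
    all_goals exact Continuous.intervalIntegrable (by fun_prop) _ _
  have h3 : ∫ z in (0 : ℝ)..x, g z ^ 2 ≤ ∫ z in (0 : ℝ)..1, g z ^ 2 :=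
    intervalIntegral.integral_mono_interval le_rfl hx.1 hx.2
      (ae_of_all _ fun z => sq_nonneg _) ((hg.pow 2).intervalIntegrable _ _)
  nlinarith [hx.2, sq_nonneg (f x)]

/-- The embedding of `W^{2,1}_2` into bounded functions, for smooth functions. -/
lemma sq_le_of_vanishesLaterally {T : ℝ} (hT : 0 < T) {φ : ℝ × ℝ → ℝ} (hφ : ContDiff ℝ ∞ φ)
    (hb : VanishesLaterally T φ) {x t : ℝ} (hx : x ∈ Icc (0 : ℝ) 1) (ht : t ∈ Icc 0 T) :
    φ (x, t) ^ 2 ≤ T⁻¹ * (∫ p, dx φ p ^ 2 ∂cylinderMeasure T)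
      + ((∫ p, dx (dx φ) p ^ 2 ∂cylinderMeasure T) + ∫ p, dt φ p ^ 2 ∂cylinderMeasure T) := by
  have hφx := contDiff_dx hφ
  have hφxx := contDiff_dx hφx
  have hφt := contDiff_dt hφ
  have hφtx := contDiff_dx hφt
  have cx := hφx.continuous
  have cxx := hφxx.continuous
  have ct := hφt.continuous
  have ctx := hφtx.continuous
  set A := ∫ p, dx (dx φ) p ^ 2 ∂cylinderMeasure T
  set B := ∫ p, dt φ p ^ 2 ∂cylinderMeasure T
  set E : ℝ → ℝ := fun τ => ∫ z in (0 : ℝ)..1, dx φ (z, τ) ^ 2 with hE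
  have hEc : Continuous E := continuous_sliceIntegral (cx.pow 2)
  -- Formally `E' = 2 ∫ φ_x φ_xt = -2 ∫ φ_xx φ_t`, with no boundary term since `φ_t` vanishes
  -- laterally; then `2|uv| ≤ u² + v²`.
  have key : ∀ s s', 0 ≤ s → s ≤ s' → s' ≤ T → |E s' - E s| ≤ A + B := by
    intro s s' h0 hss h1
    have e1 : E s' - E s = ∫ τ in s..s', ∫ z in (0 : ℝ)..1, 2 * dx φ (z, τ) * dx (dt φ) (z, τ) := by
      refine sliceIntegral_sub (F := fun p => dx φ p ^ 2)
        (Ft := fun p => 2 * dx φ p * dx (dt φ) p) (by fun_prop) (by fun_prop) (fun z τ => ?_) s s'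
      rw [← dt_dx_comm hφ]
      simpa using (hasDerivAt_snd (hφx.differentiable (by simp)) z τ).fun_pow 2
    have e2 : E s' - E s = - ∫ τ in s..s', ∫ z in (0 : ℝ)..1,
        2 * dx (dx φ) (z, τ) * dt φ (z, τ) := by
      rw [e1]
      refine integral_parts (u := fun p => 2 * dx φ p) (ux := fun p => 2 * dx (dx φ) p)
        (v := dt φ) (vx := dx (dt φ)) (by fun_prop) ctx
        (fun z τ => (hasDerivAt_fst (hφx.differentiable (by simp)) z τ).const_mul 2)
        (fun z τ => hasDerivAt_fst (hφt.differentiable (by simp)) z τ) hss fun τ hτ => ?_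
      exact hb.dt_eq_zero (hφ.differentiable (by simp)) ⟨h0.trans_lt hτ.1, hτ.2.trans_le h1⟩
    have e3 : ∫ p, (dx (dx φ) p ^ 2 + dt φ p ^ 2) ∂cylinderMeasure T = A + B :=
      integral_add (integrable_of_continuous (by fun_prop) T)
        (integrable_of_continuous (by fun_prop) T)
    rw [e2, abs_neg, ← e3]
    refine le_trans ?_ (intervalIntegral_le_cylinder (by fun_prop)
      (fun p => by positivity) h0 hss h1)
    rw [← setIntegral_rect (f := fun p => 2 * dx (dx φ) p * dt φ p) (by fun_prop) hss,
      ← setIntegral_rect (f := fun p => dx (dx φ) p ^ 2 + dt φ p ^ 2) (by fun_prop) hss]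
    refine (abs_integral_le_integral_abs).trans (integral_mono_ae ?_ ?_ (ae_of_all _ fun p => ?_))
    · exact ((integrableOn_of_continuous (by fun_prop) 0 1 s s').mono_set
        (Set.prod_mono Ioo_subset_Icc_self Ioo_subset_Icc_self))
    · exact ((integrableOn_of_continuous (by fun_prop) 0 1 s s').mono_set
        (Set.prod_mono Ioo_subset_Icc_self Ioo_subset_Icc_self))
    · exact abs_le.2 ⟨by nlinarith [sq_nonneg (dx (dx φ) p + dt φ p)],
        by nlinarith [sq_nonneg (dx (dx φ) p - dt φ p)]⟩
  have key2 : ∀ s ∈ Icc 0 T, E t ≤ E s + (A + B) := by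
    intro s hs
    rcases le_total s t with h | h
    · linarith [(abs_le.1 (key s t hs.1 h ht.2)).2]
    · linarith [(abs_le.1 (key t s ht.1 h hs.2)).1]
  have h1 : φ (x, t) ^ 2 ≤ E t :=
    sq_le_integral_deriv_sq (by fun_prop)
      (fun z => hasDerivAt_fst (hφ.differentiable (by simp)) z t) (hb t ht).1 hx
  -- Averaging over the starting time `s` replaces `E s` by a space-time integral, at the price of
  -- the factor `T⁻¹`.
  have h2 : T * E t ≤ (∫ p, dx φ p ^ 2 ∂cylinderMeasure T) + T * (A + B) := by
    have := intervalIntegral.integral_mono_on hT.le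
      (continuous_const.intervalIntegrable (μ := volume) 0 T)
      ((hEc.add continuous_const).intervalIntegrable 0 T) key2
    simp only [Pi.add_apply] at this
    rw [intervalIntegral.integral_add (hEc.intervalIntegrable _ _)
      (continuous_const.intervalIntegrable _ _), intervalIntegral.integral_const,
      intervalIntegral.integral_const] at this
    have h3 := intervalIntegral_le_cylinder (f := fun p => dx φ p ^ 2) (by fun_prop)
      (fun p => sq_nonneg _) le_rfl hT.le le_rfl
    simp only [sub_zero, smul_eq_mul] at this
    linarith
  have h4 : E t ≤ T⁻¹ * ((∫ p, dx φ p ^ 2 ∂cylinderMeasure T) + T * (A + B)) := by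
    rw [← div_eq_inv_mul, le_div_iff₀ hT]; linarith
  have h5 : T⁻¹ * (T * (A + B)) = A + B := by field_simp
  rw [mul_add, h5] at h4
  linarith

/-! ### Convergence of products in `L¹` -/

section Lp

variable {α : Type*} [MeasurableSpace α] {μ : Measure α}

lemma toReal_eLpNorm_two_sq {f : α → ℝ} (hf : MemLp f 2 μ) :
    (eLpNorm f 2 μ).toReal ^ 2 = ∫ x, f x ^ 2 ∂μ := by
  rw [hf.eLpNorm_eq_integral_rpow_norm (by simp) (by simp)]
  have h0 : 0 ≤ ∫ x, f x ^ 2 ∂μ := integral_nonneg fun x => sq_nonneg _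
  have h1 : ∫ x, ‖f x‖ ^ (2 : ℝ≥0∞).toReal ∂μ = ∫ x, f x ^ 2 ∂μ := by
    refine integral_congr_ae (ae_of_all _ fun x => ?_)
    simp
  rw [h1, ENNReal.toReal_ofReal (by positivity), ← Real.rpow_natCast, ← Real.rpow_mul h0]
  simp

lemma toReal_eLpNorm_sub_le {f g h : α → ℝ} (hf : MemLp f 2 μ) (hg : MemLp g 2 μ)
    (hh : MemLp h 2 μ) : (eLpNorm (f - g) 2 μ).toReal
      ≤ (eLpNorm (f - h) 2 μ).toReal + (eLpNorm (g - h) 2 μ).toReal := by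
  rw [← ENNReal.toReal_add (hf.sub hh).eLpNorm_ne_top (hg.sub hh).eLpNorm_ne_top]
  refine ENNReal.toReal_mono (ENNReal.add_ne_top.2
    ⟨(hf.sub hh).eLpNorm_ne_top, (hg.sub hh).eLpNorm_ne_top⟩) ?_
  have := eLpNorm_sub_le (hf.sub hh).1 (hg.sub hh).1 (p := 2) (by norm_num)
  rwa [sub_sub_sub_cancel_right] at this

lemma eLpNorm_one_mul_le {a b : α → ℝ} (ha : MemLp a 2 μ) (hb : MemLp b 2 μ) :
    eLpNorm (a * b) 1 μ ≤ eLpNorm a 2 μ * eLpNorm b 2 μ := by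
  have h := eLpNorm_smul_le_mul_eLpNorm (p := 2) (q := 2) (r := 1) hb.1 ha.1
  have e : a • b = a * b := funext fun x => smul_eq_mul (a x) (b x)
  rwa [e] at h

/-- Products of `L²`-convergent sequences converge in `L¹`. -/
lemma tendsto_eLpNorm_one_mul {u v : ℕ → α → ℝ} {f g : α → ℝ} (hu : ∀ n, MemLp (u n) 2 μ)
    (hv : ∀ n, MemLp (v n) 2 μ) (hf : MemLp f 2 μ) (hg : MemLp g 2 μ)
    (huf : Tendsto (fun n => eLpNorm (u n - f) 2 μ) atTop (𝓝 0))
    (hvg : Tendsto (fun n => eLpNorm (v n - g) 2 μ) atTop (𝓝 0)) :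
    Tendsto (fun n => eLpNorm (u n * v n - f * g) 1 μ) atTop (𝓝 0) := by
  have hb : ∀ n, eLpNorm (u n * v n - f * g) 1 μ ≤
      eLpNorm (u n - f) 2 μ * (eLpNorm (v n - g) 2 μ + eLpNorm g 2 μ)
        + eLpNorm f 2 μ * eLpNorm (v n - g) 2 μ := by
    intro n
    have e : u n * v n - f * g = (u n - f) * v n + f * (v n - g) := by ring
    have m := @eLpNorm_one_mul_le _ _ μ
    have h1 : eLpNorm (v n) 2 μ ≤ eLpNorm (v n - g) 2 μ + eLpNorm g 2 μ := by
      have := eLpNorm_add_le ((hv n).sub hg).1 hg.1 (p := 2) (by norm_num)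
      rwa [sub_add_cancel] at this
    rw [e]
    refine (eLpNorm_add_le (((hu n).sub hf).1.mul (hv n).1)
      (hf.1.mul ((hv n).sub hg).1) le_rfl).trans (add_le_add ?_ (m hf ((hv n).sub hg)))
    exact (m ((hu n).sub hf) (hv n)).trans (mul_le_mul_right h1 _)
  refine tendsto_of_tendsto_of_tendsto_of_le_of_le tendsto_const_nhds ?_ (fun _ => zero_le) hb
  have t1 := ENNReal.Tendsto.mul huf (Or.inr (by simpa using hg.eLpNorm_ne_top))
    (hvg.add (tendsto_const_nhds (x := eLpNorm g 2 μ))) (Or.inr ENNReal.zero_ne_top)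
  have t2 := ENNReal.Tendsto.const_mul (a := eLpNorm f 2 μ) hvg (Or.inr hf.eLpNorm_ne_top)
  simpa using t1.add t2

/-- `L²` convergence implies `L¹` convergence on a finite measure space. -/
lemma tendsto_eLpNorm_one_of_two [IsFiniteMeasure μ] {u : ℕ → α → ℝ} {f : α → ℝ}
    (hu : ∀ n, MemLp (u n) 2 μ) (hf : MemLp f 2 μ)
    (huf : Tendsto (fun n => eLpNorm (u n - f) 2 μ) atTop (𝓝 0)) :
    Tendsto (fun n => eLpNorm (u n - f) 1 μ) atTop (𝓝 0) := by
  have h1 : MemLp (1 : α → ℝ) 2 μ := memLp_const 1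
  simpa using tendsto_eLpNorm_one_mul hu (fun _ => h1) hf h1 huf (by simp)

/-- Uniformly convergent bounded multipliers preserve `L¹` convergence. -/
lemma tendsto_eLpNorm_one_multiplier {b u : ℕ → α → ℝ} {c f : α → ℝ} {K : ℝ} {e : ℕ → ℝ}
    (hu : ∀ n, AEStronglyMeasurable (u n) μ) (hf : MemLp f 1 μ)
    (hK : ∀ n, ∀ᵐ x ∂μ, |b n x| ≤ K) (he : Tendsto e atTop (𝓝 0))
    (hbc : ∀ n, ∀ᵐ x ∂μ, |b n x - c x| ≤ e n)
    (huf : Tendsto (fun n => eLpNorm (u n - f) 1 μ) atTop (𝓝 0)) :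
    Tendsto (fun n => eLpNorm (b n * u n - c * f) 1 μ) atTop (𝓝 0) := by
  have hb : ∀ n, eLpNorm (b n * u n - c * f) 1 μ ≤
      ENNReal.ofReal K * eLpNorm (u n - f) 1 μ + ENNReal.ofReal (e n) * eLpNorm f 1 μ := by
    intro n
    have h1 : eLpNorm (b n * u n - c * f) 1 μ
        ≤ eLpNorm ((fun x => K * ‖(u n - f) x‖) + fun x => e n * ‖f x‖) 1 μ := by
      refine eLpNorm_mono_ae_real ?_
      filter_upwards [hK n, hbc n] with x hx1 hx2
      have : (b n * u n - c * f) x = b n x * (u n - f) x + (b n x - c x) * f x := by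
        simp only [Pi.sub_apply, Pi.mul_apply]; ring
      rw [this]
      refine (norm_add_le _ _).trans ?_
      rw [norm_mul, norm_mul, Pi.add_apply]
      exact add_le_add (mul_le_mul_of_nonneg_right hx1 (norm_nonneg _))
        (mul_le_mul_of_nonneg_right hx2 (norm_nonneg _))
    have h2 : ∀ (k : ℝ) (v : α → ℝ), eLpNorm (fun x => k * ‖v x‖) 1 μ
        ≤ ENNReal.ofReal |k| * eLpNorm v 1 μ := by
      intro k v
      have := eLpNorm_const_smul_le (c := k) (f := fun x => ‖v x‖) (p := 1) (μ := μ)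
      rw [eLpNorm_norm, Real.enorm_eq_ofReal_abs] at this
      exact this
    -- The signs of `K` and `e n` are read off from the a.e. bounds at some point, which exists only
    -- if `μ ≠ 0`.
    rcases eq_or_ne μ 0 with rfl | hμ
    · simp
    have : NeBot (ae μ) := ae_neBot.2 hμ
    have hK0 : 0 ≤ K := by
      obtain ⟨x, hx⟩ := (hK n).exists
      exact (abs_nonneg _).trans hx
    have he0 : 0 ≤ e n := by
      obtain ⟨x, hx⟩ := (hbc n).exists
      exact (abs_nonneg _).trans hx
    refine h1.trans ((eLpNorm_add_le (((hu n).sub hf.1).norm.const_mul K)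
      (hf.1.norm.const_mul (e n)) le_rfl).trans (add_le_add ?_ ?_))
    · simpa [abs_of_nonneg hK0] using h2 K (u n - f)
    · simpa [abs_of_nonneg he0] using h2 (e n) f
  refine tendsto_of_tendsto_of_tendsto_of_le_of_le tendsto_const_nhds ?_ (fun _ => zero_le) hb
  have t1 := ENNReal.Tendsto.const_mul (a := ENNReal.ofReal K) huf (Or.inr ENNReal.ofReal_ne_top)
  have t2 := ENNReal.Tendsto.mul_const (b := eLpNorm f 1 μ) (ENNReal.tendsto_ofReal he)
    (Or.inr hf.eLpNorm_ne_top)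
  simpa using t1.add t2

lemma tendsto_eLpNorm_one_add {u v : ℕ → α → ℝ} {f g : α → ℝ}
    (hu : ∀ n, AEStronglyMeasurable (u n - f) μ) (hv : ∀ n, AEStronglyMeasurable (v n - g) μ)
    (huf : Tendsto (fun n => eLpNorm (u n - f) 1 μ) atTop (𝓝 0))
    (hvg : Tendsto (fun n => eLpNorm (v n - g) 1 μ) atTop (𝓝 0)) :
    Tendsto (fun n => eLpNorm (u n + v n - (f + g)) 1 μ) atTop (𝓝 0) := by
  refine tendsto_of_tendsto_of_tendsto_of_le_of_le tendsto_const_nhds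
    (by simpa using huf.add hvg) (fun _ => zero_le) fun n => ?_
  rw [add_sub_add_comm]
  exact eLpNorm_add_le (hu n) (hv n) le_rfl

end Lp

/-! ### Test functions and weak derivatives -/

lemma IsTest.continuous {E : Type*} [NormedAddCommGroup E] [NormedSpace ℝ E] {Ω : Set E}
    {φ : E → ℝ} (hφ : IsTest Ω φ) : Continuous φ := hφ.smooth.continuous

lemma IsTest.dx {T : ℝ} {ψ : ℝ × ℝ → ℝ} (hψ : IsTest (cylinder T) ψ) :
    IsTest (cylinder T) (dx ψ) := by
  have hs : tsupport (QuasilinearParabolic.dx ψ) ⊆ tsupport ψ :=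
    (tsupport_fderiv_apply_subset ℝ (f := ψ) (1, 0))
  exact ⟨contDiff_dx hψ.smooth, hψ.compact.of_isClosed_subset (isClosed_tsupport _) hs,
    hs.trans hψ.support_subset⟩

/-- The test function vanishes off the cylinder. This passes between the restricted integrals
defining weak derivatives and the integrals over the plane used in integration by parts and in the
proof of uniqueness. -/
lemma IsTest.setIntegral_mul {T : ℝ} {ψ : ℝ × ℝ → ℝ} (hψ : IsTest (cylinder T) ψ)
    (u : ℝ × ℝ → ℝ) : ∫ p, u p * ψ p ∂cylinderMeasure T = ∫ p, u p * ψ p := by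
  refine setIntegral_eq_integral_of_forall_compl_eq_zero fun p hp => ?_
  rw [image_eq_zero_of_notMem_tsupport fun h => hp (hψ.support_subset h), mul_zero]

/-- Classical derivatives are weak derivatives. -/
lemma isWeakDx_of_contDiff {T : ℝ} {u : ℝ × ℝ → ℝ} (hu : ContDiff ℝ 1 u) :
    IsWeakDx T u (dx u) := by
  intro ψ hψ
  have c1 : Continuous (dx u) := (hu.continuous_fderiv (by simp)).clm_apply continuous_const
  rw [hψ.dx.setIntegral_mul, hψ.setIntegral_mul]
  refine integral_mul_fderiv_eq_neg_fderiv_mul_of_integrable ?_ ?_ ?_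
    (fun x _ => hu.differentiable (by simp) x) (fun x _ => hψ.smooth.differentiable (by simp) x)
  · exact (c1.mul hψ.continuous).integrable_of_hasCompactSupport hψ.compact.mul_left
  · exact (hu.continuous.mul hψ.dx.continuous).integrable_of_hasCompactSupport
      hψ.dx.compact.mul_left
  · exact (hu.continuous.mul hψ.continuous).integrable_of_hasCompactSupport hψ.compact.mul_left

lemma IsTest.exists_bound {T : ℝ} {ψ : ℝ × ℝ → ℝ} (hψ : IsTest (cylinder T) ψ) :
    ∃ C, ∀ p, |ψ p| ≤ C :=
  hψ.continuous.bounded_above_of_compact_support hψ.compact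

lemma IsTest.integrable_mul {T : ℝ} {ψ f : ℝ × ℝ → ℝ} (hψ : IsTest (cylinder T) ψ)
    (hf : Integrable f (cylinderMeasure T)) :
    Integrable (fun p => f p * ψ p) (cylinderMeasure T) := by
  obtain ⟨C, hC⟩ := hψ.exists_bound
  exact hf.mul_bdd (c := C) hψ.continuous.aestronglyMeasurable (ae_of_all _ hC)

lemma IsTest.tendsto_integral_mul {T : ℝ} {ψ : ℝ × ℝ → ℝ} (hψ : IsTest (cylinder T) ψ)
    {u : ℕ → ℝ × ℝ → ℝ} {f : ℝ × ℝ → ℝ} (hu : ∀ n, Integrable (u n) (cylinderMeasure T))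
    (hf : Integrable f (cylinderMeasure T))
    (huf : Tendsto (fun n => eLpNorm (u n - f) 1 (cylinderMeasure T)) atTop (𝓝 0)) :
    Tendsto (fun n => ∫ p, u n p * ψ p ∂cylinderMeasure T) atTop
      (𝓝 (∫ p, f p * ψ p ∂cylinderMeasure T)) := by
  obtain ⟨C, hC⟩ := hψ.exists_bound
  refine tendsto_integral_of_L1' _ (hψ.integrable_mul hf).1
    (Eventually.of_forall fun n => hψ.integrable_mul (hu n)) ?_
  have := tendsto_eLpNorm_one_multiplier (b := fun _ => ψ) (c := ψ) (e := fun _ => 0)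
    (fun n => (hu n).1) (memLp_one_iff_integrable.2 hf) (fun _ => ae_of_all _ hC)
    tendsto_const_nhds (fun _ => ae_of_all _ fun p => by simp) huf
  refine this.congr fun n => ?_
  congr 1
  ext p
  simp [mul_comm]

/-- Weak derivatives are stable under `L¹` convergence. -/
lemma IsWeakDx.of_tendsto {T : ℝ} {u v : ℕ → ℝ × ℝ → ℝ} {f g : ℝ × ℝ → ℝ}
    (h : ∀ n, IsWeakDx T (u n) (v n))
    (hu : ∀ n, Integrable (u n) (cylinderMeasure T)) (hf : Integrable f (cylinderMeasure T))
    (hv : ∀ n, Integrable (v n) (cylinderMeasure T)) (hg : Integrable g (cylinderMeasure T))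
    (huf : Tendsto (fun n => eLpNorm (u n - f) 1 (cylinderMeasure T)) atTop (𝓝 0))
    (hvg : Tendsto (fun n => eLpNorm (v n - g) 1 (cylinderMeasure T)) atTop (𝓝 0)) :
    IsWeakDx T f g := fun ψ hψ =>
  tendsto_nhds_unique ((hψ.dx.tendsto_integral_mul hu hf huf).congr fun n => h n ψ hψ)
    (hψ.tendsto_integral_mul hv hg hvg).neg

/-- Weak derivatives are unique. -/
lemma IsWeakDx.unique {T : ℝ} {u v w : ℝ × ℝ → ℝ} (hv : IsWeakDx T u v) (hw : IsWeakDx T u w)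
    (iv : Integrable v (cylinderMeasure T)) (iw : Integrable w (cylinderMeasure T)) :
    v =ᵐ[cylinderMeasure T] w := by
  have := (isOpen_cylinder T).ae_eq_zero_of_integral_contDiff_smul_eq_zero (μ := volume)
    (f := v - w) (IntegrableOn.locallyIntegrableOn (iv.sub iw)) fun ψ h1 h2 h3 => by
      have hψ : IsTest (cylinder T) ψ := ⟨h1, h2, h3⟩
      have e := (hv ψ hψ).symm.trans (hw ψ hψ)
      have e2 := integral_sub (hψ.integrable_mul iv) (hψ.integrable_mul iw)
      rw [neg_inj.1 e, sub_self] at e2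
      have e3 := hψ.setIntegral_mul (v - w)
      simp only [Pi.sub_apply, sub_mul] at e3
      rw [e2] at e3
      rw [e3]
      refine integral_congr_ae (ae_of_all _ fun p => ?_)
      simp only [Pi.sub_apply, smul_eq_mul]
      ring
  have h2 := (ae_restrict_iff' (isOpen_cylinder T).measurableSet).2 this
  filter_upwards [h2] with p hp
  exact sub_eq_zero.1 hp

/-! ### Flux, residual and energy inequality -/

/-- The expanded space derivative of the flux `a(φ) φ_x`. -/
noncomputable def fluxDx (a : ℝ → ℝ) (φ φx φxx : ℝ × ℝ → ℝ) (p : ℝ × ℝ) : ℝ :=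
  deriv a (φ p) * (φx p * φx p) + a (φ p) * φxx p

/-- The defect of a smooth function in the equation. -/
noncomputable def residual (a : ℝ → ℝ) (φ : ℝ × ℝ → ℝ) (p : ℝ × ℝ) : ℝ :=
  dt φ p - fluxDx a φ (dx φ) (dx (dx φ)) p

section Smooth

variable {a : ℝ → ℝ} {φ : ℝ × ℝ → ℝ}

lemma continuous_fluxDx (ha : ContDiff ℝ 2 a) (hφ : ContDiff ℝ ∞ φ) :
    Continuous (fluxDx a φ (dx φ) (dx (dx φ))) := by
  have h1 := hφ.continuous
  have h2 := (contDiff_dx hφ).continuous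
  have h3 := (contDiff_dx (contDiff_dx hφ)).continuous
  have h4 := ha.continuous
  have h5 : Continuous (deriv a) := ha.continuous_deriv (by norm_num)
  unfold fluxDx
  fun_prop

lemma continuous_residual (ha : ContDiff ℝ 2 a) (hφ : ContDiff ℝ ∞ φ) :
    Continuous (residual a φ) :=
  (contDiff_dt hφ).continuous.sub (continuous_fluxDx ha hφ)

lemma hasDerivAt_flux (ha : ContDiff ℝ 2 a) (hφ : ContDiff ℝ ∞ φ) (x t : ℝ) :
    HasDerivAt (fun x => a (φ (x, t)) * dx φ (x, t)) (fluxDx a φ (dx φ) (dx (dx φ)) (x, t)) x := by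
  have h1 : HasDerivAt (fun x => φ (x, t)) (dx φ (x, t)) x :=
    hasDerivAt_fst (hφ.differentiable (by simp)) x t
  have h2 := hasDerivAt_fst ((contDiff_dx hφ).differentiable (by simp)) x t
  have h3 : HasDerivAt (fun x => a (φ (x, t))) (deriv a (φ (x, t)) * dx φ (x, t)) x :=
    (ha.differentiable (by norm_num) (φ (x, t))).hasDerivAt.comp x h1
  refine (h3.fun_mul h2).congr_deriv ?_
  simp only [fluxDx]
  ring

lemma isWeakDx_flux (T : ℝ) (ha : ContDiff ℝ 2 a) (hφ : ContDiff ℝ ∞ φ) :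
    IsWeakDx T (fun p => a (φ p) * dx φ p) (fluxDx a φ (dx φ) (dx (dx φ))) := by
  have hu : ContDiff ℝ 1 (fun p => a (φ p) * dx φ p) :=
    ((ha.of_le (by norm_num)).comp (hφ.of_le (by simp))).mul
      ((contDiff_dx hφ).of_le (by simp))
  have e : dx (fun p => a (φ p) * dx φ p) = fluxDx a φ (dx φ) (dx (dx φ)) := by
    ext ⟨x, t⟩
    exact (hasDerivAt_fst (hu.differentiable (by norm_num)) x t).unique (hasDerivAt_flux ha hφ x t)
  rw [← e]
  exact isWeakDx_of_contDiff hu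

/-- The energy inequality for smooth functions. -/
lemma energy_le {T : ℝ} (ha : ContDiff ℝ 2 a) (hφ : ContDiff ℝ ∞ φ)
    (hb : VanishesLaterally T φ) {G g g' : ℝ → ℝ} (hG : ∀ u, HasDerivAt G (g u) u)
    (hg : ∀ u, HasDerivAt g (g' u) u) (hg' : Continuous g') (h0 : g 0 = 0) {C : ℝ}
    (hC : ∀ p ∈ cylinder T, |g (φ p)| ≤ C) {s t : ℝ} (hs : 0 ≤ s) (hst : s ≤ t) (ht : t ≤ T) :
    (∫ x in (0 : ℝ)..1, G (φ (x, t)))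
        + ∫ τ in s..t, ∫ x in (0 : ℝ)..1, g' (φ (x, τ)) * a (φ (x, τ)) * dx φ (x, τ) ^ 2
      ≤ (∫ x in (0 : ℝ)..1, G (φ (x, s))) + C * ∫ p, |residual a φ p| ∂cylinderMeasure T := by
  have cG : Continuous G := continuous_iff_continuousAt.2 fun u => (hG u).continuousAt
  have cg : Continuous g := continuous_iff_continuousAt.2 fun u => (hg u).continuousAt
  have ca := ha.continuous
  have c := hφ.continuous
  have cx := (contDiff_dx hφ).continuous
  have ct := (contDiff_dt hφ).continuous
  have cr := continuous_residual ha hφ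
  have cf := continuous_fluxDx ha hφ
  have hd := hφ.differentiable (by simp)
  have e1 : (∫ x in (0 : ℝ)..1, G (φ (x, t))) - ∫ x in (0 : ℝ)..1, G (φ (x, s))
      = ∫ τ in s..t, ∫ x in (0 : ℝ)..1, g (φ (x, τ)) * dt φ (x, τ) :=
    sliceIntegral_sub (F := fun p => G (φ p)) (Ft := fun p => g (φ p) * dt φ p)
      (by fun_prop) (by fun_prop)
      (fun x τ => (hG (φ (x, τ))).comp τ (hasDerivAt_snd hd x τ)) s t
  -- The condition `g 0 = 0` is what makes `g (φ)` vanish laterally and removes the boundary terms.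
  have e2 := integral_parts (u := fun p => a (φ p) * dx φ p)
    (ux := fluxDx a φ (dx φ) (dx (dx φ))) (v := fun p => g (φ p))
    (vx := fun p => g' (φ p) * dx φ p) cf (by fun_prop) (hasDerivAt_flux ha hφ)
    (fun x τ => (hg (φ (x, τ))).comp x (hasDerivAt_fst hd x τ)) hst fun τ hτ => by
      obtain ⟨b0, b1⟩ := hb τ ⟨hs.trans hτ.1.le, hτ.2.le.trans ht⟩
      simp [b0, b1, h0]
  have e3 : ∫ τ in s..t, ∫ x in (0 : ℝ)..1, g (φ (x, τ)) * dt φ (x, τ)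
      = (∫ τ in s..t, ∫ x in (0 : ℝ)..1, g (φ (x, τ)) * residual a φ (x, τ))
        + ∫ τ in s..t, ∫ x in (0 : ℝ)..1,
          fluxDx a φ (dx φ) (dx (dx φ)) (x, τ) * g (φ (x, τ)) := by
    rw [← setIntegral_rect (f := fun p => g (φ p) * dt φ p) (by fun_prop) hst,
      ← setIntegral_rect (f := fun p => g (φ p) * residual a φ p) (by fun_prop) hst,
      ← setIntegral_rect (f := fun p => fluxDx a φ (dx φ) (dx (dx φ)) p * g (φ p))
        (by fun_prop) hst, ← integral_add]
    · refine integral_congr_ae (ae_of_all _ fun p => ?_)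
      simp only [residual]
      ring
    all_goals
      exact (integrableOn_of_continuous (by fun_prop) 0 1 s t).mono_set
        (Set.prod_mono Ioo_subset_Icc_self Ioo_subset_Icc_self)
  -- The multiplier is estimated in sup norm, so that the residual is needed only in `L¹`.
  have e4 : ∫ τ in s..t, ∫ x in (0 : ℝ)..1, g (φ (x, τ)) * residual a φ (x, τ)
      ≤ C * ∫ p, |residual a φ p| ∂cylinderMeasure T := by
    have e5 : ∫ τ in s..t, ∫ x in (0 : ℝ)..1, g (φ (x, τ)) * residual a φ (x, τ)
        ≤ ∫ τ in s..t, ∫ x in (0 : ℝ)..1, |g (φ (x, τ)) * residual a φ (x, τ)| := by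
      rw [← setIntegral_rect (f := fun p => g (φ p) * residual a φ p) (by fun_prop) hst,
        ← setIntegral_rect (f := fun p => |g (φ p) * residual a φ p|) (by fun_prop) hst]
      exact (le_abs_self _).trans abs_integral_le_integral_abs
    refine e5.trans ((intervalIntegral_le_cylinder (f := fun p => |g (φ p) * residual a φ p|)
      (by fun_prop) (fun p => abs_nonneg _) hs hst ht).trans ?_)
    rw [← integral_const_mul]
    refine integral_mono_ae (integrable_of_continuous (by fun_prop) T)
      (integrable_of_continuous (by fun_prop) T) ?_
    filter_upwards [ae_mem_cylinder T] with p hp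
    rw [abs_mul]
    exact mul_le_mul_of_nonneg_right (hC p hp) (abs_nonneg _)
  have e6 : ∫ τ in s..t, ∫ x in (0 : ℝ)..1, g' (φ (x, τ)) * a (φ (x, τ)) * dx φ (x, τ) ^ 2
      = ∫ τ in s..t, ∫ x in (0 : ℝ)..1,
        a (φ (x, τ)) * dx φ (x, τ) * (g' (φ (x, τ)) * dx φ (x, τ)) := by
    refine intervalIntegral.integral_congr fun τ _ => intervalIntegral.integral_congr fun x _ => ?_
    ring
  rw [e6]
  linarith

end Smooth

/-! ### Maximum principle and smoothing estimate for limits of approximate solutions -/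

/-- With exponent at least two both one-sided derivatives at `0` vanish, so they agree there. The
cases `n = 1` and `n = 0` differentiate the truncated powers of the maximum principle. -/
lemma hasDerivAt_max_zero_pow (n : ℕ) (v : ℝ) :
    HasDerivAt (fun v : ℝ => max v 0 ^ (n + 2)) ((n + 2 : ℝ) * max v 0 ^ (n + 1)) v := by
  have hp : ∀ v : ℝ, 0 ≤ v → HasDerivWithinAt (fun v : ℝ => max v 0 ^ (n + 2))
      ((n + 2 : ℝ) * max v 0 ^ (n + 1)) (Ici 0) v := by
    intro v hv
    rw [max_eq_left hv]
    have := (hasDerivAt_pow (n + 2) v).hasDerivWithinAt (s := Ici 0)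
    refine (this.congr (fun w hw => by rw [max_eq_left hw]) (by rw [max_eq_left hv])).congr_deriv ?_
    push_cast
    rfl
  have hm : ∀ v : ℝ, v ≤ 0 → HasDerivWithinAt (fun v : ℝ => max v 0 ^ (n + 2))
      ((n + 2 : ℝ) * max v 0 ^ (n + 1)) (Iic 0) v := by
    intro v hv
    rw [max_eq_right hv]
    refine ((hasDerivWithinAt_const v (Iic 0) (0 : ℝ)).congr
      (fun w hw => by rw [max_eq_right hw]; simp) (by rw [max_eq_right hv]; simp)).congr_deriv ?_
    simp
  rcases lt_trichotomy v 0 with h | h | h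
  · exact (hm v h.le).hasDerivAt (Iic_mem_nhds h)
  · subst h
    have := (hm 0 le_rfl).union (hp 0 le_rfl)
    rwa [Iic_union_Ici, hasDerivWithinAt_univ] at this
  · exact (hp v h.le).hasDerivAt (Ici_mem_nhds h)

/-- `φ n` are smooth, vanish laterally and converge uniformly to `Y` on the closed cylinder, with
errors bounded by `e n`, and are approximate solutions. -/
structure IsApproxSolution (a : ℝ → ℝ) (T : ℝ) (φ : ℕ → ℝ × ℝ → ℝ) (e : ℕ → ℝ)
    (Y : ℝ × ℝ → ℝ) : Prop where
  smooth : ∀ n, ContDiff ℝ ∞ (φ n)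
  lateral : ∀ n, VanishesLaterally T (φ n)
  tendsto : Tendsto e atTop (𝓝 0)
  abs_sub_le : ∀ n, ∀ p ∈ Icc (0 : ℝ) 1 ×ˢ Icc (0 : ℝ) T, |φ n p - Y p| ≤ e n
  continuousOn : ContinuousOn Y (Icc (0 : ℝ) 1 ×ˢ Icc (0 : ℝ) T)
  residual : Tendsto (fun n => ∫ p, |residual a (φ n) p| ∂cylinderMeasure T) atTop (𝓝 0)

namespace IsApproxSolution

variable {a : ℝ → ℝ} {T : ℝ} {φ : ℕ → ℝ × ℝ → ℝ} {e : ℕ → ℝ} {Y : ℝ × ℝ → ℝ}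

lemma exists_bound (h : IsApproxSolution a T φ e Y) :
    ∃ B, ∀ n, ∀ p ∈ Icc (0 : ℝ) 1 ×ˢ Icc (0 : ℝ) T, |φ n p| ≤ B := by
  obtain ⟨B, hB⟩ := (isCompact_Icc.prod isCompact_Icc).exists_bound_of_continuousOn h.continuousOn
  obtain ⟨E, hE⟩ := h.tendsto.bddAbove_range
  refine ⟨B + E, fun n p hp => ?_⟩
  have h1 := h.abs_sub_le n p hp
  have h2 : |Y p| ≤ B := hB p hp
  have h3 : e n ≤ E := hE (mem_range_self n)
  have := abs_sub_abs_le_abs_sub (φ n p) (Y p)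
  linarith

lemma exists_comp_bound (h : IsApproxSolution a T φ e Y) {G : ℝ → ℝ} (hG : Continuous G) :
    ∃ C, ∀ n, ∀ p ∈ Icc (0 : ℝ) 1 ×ˢ Icc (0 : ℝ) T, |G (φ n p)| ≤ C := by
  obtain ⟨B, hB⟩ := h.exists_bound
  obtain ⟨C, hC⟩ := (isCompact_Icc (a := -B) (b := B)).exists_bound_of_continuousOn hG.continuousOn
  exact ⟨C, fun n p hp => hC _ (abs_le.1 (hB n p hp))⟩

lemma tendsto_apply (h : IsApproxSolution a T φ e Y) {p : ℝ × ℝ}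
    (hp : p ∈ Icc (0 : ℝ) 1 ×ˢ Icc (0 : ℝ) T) : Tendsto (fun n => φ n p) atTop (𝓝 (Y p)) := by
  rw [tendsto_iff_dist_tendsto_zero]
  exact squeeze_zero (fun _ => dist_nonneg) (fun n => h.abs_sub_le n p hp) h.tendsto

lemma tendsto_sliceIntegral (h : IsApproxSolution a T φ e Y) {G : ℝ → ℝ} (hG : Continuous G)
    {t : ℝ} (ht : t ∈ Icc 0 T) :
    Tendsto (fun n => ∫ x in (0 : ℝ)..1, G (φ n (x, t))) atTop
      (𝓝 (∫ x in (0 : ℝ)..1, G (Y (x, t)))) := by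
  obtain ⟨C, hC⟩ := h.exists_comp_bound hG
  have hm : ∀ x ∈ uIoc (0 : ℝ) 1, (x, t) ∈ Icc (0 : ℝ) 1 ×ˢ Icc (0 : ℝ) T := fun x hx => by
    rw [uIoc_of_le zero_le_one] at hx
    exact ⟨⟨hx.1.le, hx.2⟩, ht⟩
  refine intervalIntegral.tendsto_integral_filter_of_dominated_convergence (fun _ => C)
    (Eventually.of_forall fun n => ?_) (Eventually.of_forall fun n => ae_of_all _ fun x hx => ?_)
    intervalIntegrable_const (ae_of_all _ fun x hx => ?_)
  · have := (h.smooth n).continuous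
    exact Continuous.aestronglyMeasurable (by fun_prop)
  · exact hC n _ (hm x hx)
  · exact (hG.tendsto _).comp (h.tendsto_apply (hm x hx))

lemma continuousOn_slice (h : IsApproxSolution a T φ e Y) {t : ℝ} (ht : t ∈ Icc 0 T) :
    ContinuousOn (fun x => Y (x, t)) (Icc 0 1) :=
  h.continuousOn.comp (by fun_prop) fun _ hx => ⟨hx, ht⟩

/-- The maximum principle. -/
lemma abs_le_of_abs_le (h : IsApproxSolution a T φ e Y) (ha : ContDiff ℝ 2 a)
    (ha0 : ∀ u, 0 ≤ a u) {k s t : ℝ} (hk : 0 ≤ k) (hs : 0 ≤ s) (hst : s ≤ t) (ht : t ≤ T)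
    (hY : ∀ x ∈ Icc (0 : ℝ) 1, |Y (x, s)| ≤ k) : ∀ x ∈ Icc (0 : ℝ) 1, |Y (x, t)| ≤ k := by
  -- `G` vanishes on `|u| ≤ k` and is positive elsewhere. The cube makes it `C²`, as `energy_le`
  -- requires, and `g' ≥ 0` lets the dissipation term be dropped.
  set G : ℝ → ℝ := fun u => max (u ^ 2 - k ^ 2) 0 ^ 3 with hGdef
  set g : ℝ → ℝ := fun u => 6 * u * max (u ^ 2 - k ^ 2) 0 ^ 2 with hgdef
  set g' : ℝ → ℝ := fun u => 6 * max (u ^ 2 - k ^ 2) 0 ^ 2 + 24 * u ^ 2 * max (u ^ 2 - k ^ 2) 0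
    with hg'def
  have cG : Continuous G := by fun_prop
  have cg : Continuous g := by fun_prop
  have cg' : Continuous g' := by fun_prop
  have hi : ∀ u : ℝ, HasDerivAt (fun u : ℝ => u ^ 2 - k ^ 2) (2 * u) u := fun u => by
    simpa using (hasDerivAt_pow 2 u).sub_const (k ^ 2)
  have hG : ∀ u, HasDerivAt G (g u) u := fun u => by
    refine ((hasDerivAt_max_zero_pow 1 (u ^ 2 - k ^ 2)).comp u (hi u)).congr_deriv ?_
    simp only [hgdef]
    push_cast
    ring
  have hg : ∀ u, HasDerivAt g (g' u) u := fun u => by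
    have h1 := (hasDerivAt_max_zero_pow 0 (u ^ 2 - k ^ 2)).comp u (hi u)
    refine (((hasDerivAt_id u).const_mul 6).fun_mul h1).congr_deriv ?_
    simp only [hg'def, id, Function.comp]
    push_cast
    ring
  have hg0 : ∀ u, 0 ≤ g' u := fun u => by
    have := le_max_right (u ^ 2 - k ^ 2) 0
    simp only [hg'def]
    positivity
  have hG0 : ∀ u, 0 ≤ G u := fun u => pow_nonneg (le_max_right _ _) _
  have hGk : ∀ u, |u| ≤ k → G u = 0 := fun u hu => by
    simp only [hGdef]
    rw [max_eq_right]
    · simp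
    · rw [sub_nonpos]; exact sq_le_sq' (abs_le.1 hu).1 (abs_le.1 hu).2
  have hsT : s ∈ Icc 0 T := ⟨hs, hst.trans ht⟩
  have htT : t ∈ Icc 0 T := ⟨hs.trans hst, ht⟩
  obtain ⟨C, hC⟩ := h.exists_comp_bound cg
  have hle : ∫ x in (0 : ℝ)..1, G (Y (x, t)) ≤ 0 := by
    have hz : ∫ x in (0 : ℝ)..1, G (Y (x, s)) = 0 := by
      rw [intervalIntegral.integral_congr (g := fun _ => (0 : ℝ)), intervalIntegral.integral_zero]
      intro x hx
      rw [uIcc_of_le zero_le_one] at hx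
      exact hGk _ (hY x hx)
    -- In the limit the residual error disappears and the integral at time `s` is zero by the bound
    -- on `Y`.
    have hlim := (h.tendsto_sliceIntegral cG hsT).add (h.residual.const_mul C)
    rw [hz, mul_zero, add_zero] at hlim
    refine le_of_tendsto_of_tendsto' (h.tendsto_sliceIntegral cG htT) hlim fun n => ?_
    have h1 := energy_le ha (h.smooth n) (h.lateral n) hG hg cg' (by simp [hgdef])
      (fun p hp => hC n p (cylinder_subset T hp)) hs hst ht
    have h2 : 0 ≤ ∫ τ in s..t, ∫ x in (0 : ℝ)..1,
        g' (φ n (x, τ)) * a (φ n (x, τ)) * dx (φ n) (x, τ) ^ 2 :=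
      intervalIntegral.integral_nonneg hst fun τ _ =>
        intervalIntegral.integral_nonneg zero_le_one fun x _ =>
          mul_nonneg (mul_nonneg (hg0 _) (ha0 _)) (sq_nonneg _)
    linarith
  intro x hx
  by_contra hlt
  rw [not_le] at hlt
  have hpos : 0 < G (Y (x, t)) := by
    have : k ^ 2 < Y (x, t) ^ 2 := by rw [← sq_abs (Y (x, t))]; gcongr
    exact pow_pos (lt_max_of_lt_left (sub_pos.2 this)) 3
  exact absurd (intervalIntegral.integral_pos zero_lt_one
    (cG.comp_continuousOn (h.continuousOn_slice htT)) (fun x _ => hG0 _) ⟨x, hx, hpos⟩) hle.not_gt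

/-- The smoothing estimate. -/
lemma mul_sq_le (h : IsApproxSolution a T φ e Y) (ha : ContDiff ℝ 2 a) {ρ : ℝ} (hρ : 0 < ρ)
    (haρ : ∀ u, ρ ≤ a u) {x t : ℝ} (hx : x ∈ Icc (0 : ℝ) 1) (ht : t ∈ Ioc 0 T) :
    2 * ρ * t * Y (x, t) ^ 2 ≤ ∫ z in (0 : ℝ)..1, Y (z, 0) ^ 2 := by
  have ht0 := ht.1.le
  set m := |Y (x, t)| with hm
  rcases (abs_nonneg (Y (x, t))).eq_or_lt with h0 | hmpos
  · rw [abs_eq_zero.1 h0.symm]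
    simpa using intervalIntegral.integral_nonneg zero_le_one fun z _ => sq_nonneg (Y (z, 0))
  -- Apply the maximum principle from `s` to `t`, with `k` the maximum of `|Y(·, s)|`: this yields
  -- `m ≤ k`.
  have hex : ∀ s ∈ Icc 0 t, ∃ z ∈ Icc (0 : ℝ) 1, m ≤ |Y (z, s)| := by
    intro s hs
    have hsT : s ∈ Icc 0 T := ⟨hs.1, hs.2.trans ht.2⟩
    obtain ⟨z, hz, hmax⟩ := isCompact_Icc.exists_isMaxOn (nonempty_Icc.2 zero_le_one)
      (h.continuousOn_slice hsT).abs
    exact ⟨z, hz, h.abs_le_of_abs_le ha (fun u => hρ.le.trans (haρ u)) (abs_nonneg _) hs.1 hs.2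
      ht.2 (fun w hw => hmax hw) x hx⟩
  obtain ⟨C, hC⟩ := h.exists_comp_bound (G := fun u => 2 * u) (by fun_prop)
  have hlim := (h.tendsto_sliceIntegral (G := fun u => u ^ 2) (by fun_prop)
    ⟨le_rfl, ht0.trans ht.2⟩).add (h.residual.const_mul C)
  rw [mul_zero, add_zero] at hlim
  have hlim2 : Tendsto (fun n => 2 * ρ * t * (m - e n) ^ 2) atTop (𝓝 (2 * ρ * t * m ^ 2)) := by
    have := ((tendsto_const_nhds (x := m)).sub h.tendsto).pow 2
    rw [sub_zero] at this
    exact this.const_mul _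
  rw [← sq_abs (Y (x, t))]
  refine le_of_tendsto_of_tendsto hlim2 hlim ?_
  -- Once `e n < m`, the lower bound `m - e n` for a value of `|φ n|` is positive and may be
  -- squared.
  filter_upwards [h.tendsto.eventually_lt_const hmpos] with n hn
  have hd := (h.smooth n).differentiable (by simp)
  have c := (h.smooth n).continuous
  have cx := (contDiff_dx (h.smooth n)).continuous
  have ca := ha.continuous
  have h1 := energy_le ha (h.smooth n) (h.lateral n) (G := fun u => u ^ 2) (g := fun u => 2 * u)
    (g' := fun _ => 2) (fun u => by simpa using hasDerivAt_pow 2 u)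
    (fun u => by simpa using (hasDerivAt_id u).const_mul 2) continuous_const (by simp)
    (fun p hp => hC n p (cylinder_subset T hp)) le_rfl ht0 ht.2
  have h2 : 0 ≤ ∫ z in (0 : ℝ)..1, φ n (z, t) ^ 2 :=
    intervalIntegral.integral_nonneg zero_le_one fun z _ => sq_nonneg _
  -- Lower bound for the dissipation at each time: `φ n` is zero at `x = 0` and reaches size `m - e
  -- n` somewhere in `[0,1]`.
  have h3 : ∀ τ ∈ Icc 0 t, 2 * ρ * (m - e n) ^ 2
      ≤ ∫ z in (0 : ℝ)..1, 2 * a (φ n (z, τ)) * dx (φ n) (z, τ) ^ 2 := by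
    intro τ hτ
    have hτT : τ ∈ Icc 0 T := ⟨hτ.1, hτ.2.trans ht.2⟩
    obtain ⟨z, hz, hmz⟩ := hex τ hτ
    have h4 := h.abs_sub_le n (z, τ) ⟨hz, hτT⟩
    have h5 : m - e n ≤ |φ n (z, τ)| := by
      have := abs_sub_abs_le_abs_sub (Y (z, τ)) (φ n (z, τ))
      rw [abs_sub_comm] at this
      linarith
    have h6 : (m - e n) ^ 2 ≤ φ n (z, τ) ^ 2 := by
      rw [← sq_abs (φ n (z, τ))]
      exact pow_le_pow_left₀ (sub_nonneg.2 hn.le) h5 2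
    have h7 : φ n (z, τ) ^ 2 ≤ ∫ w in (0 : ℝ)..1, dx (φ n) (w, τ) ^ 2 :=
      sq_le_integral_deriv_sq (f := fun w => φ n (w, τ)) (by fun_prop)
        (fun w => hasDerivAt_fst hd w τ) (h.lateral n τ hτT).1 hz
    calc 2 * ρ * (m - e n) ^ 2 ≤ 2 * ρ * ∫ w in (0 : ℝ)..1, dx (φ n) (w, τ) ^ 2 := by
          gcongr; exact h6.trans h7
      _ = ∫ w in (0 : ℝ)..1, 2 * ρ * dx (φ n) (w, τ) ^ 2 := by
          rw [intervalIntegral.integral_const_mul]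
      _ ≤ _ := by
          refine intervalIntegral.integral_mono_on zero_le_one
            (Continuous.intervalIntegrable (by fun_prop) _ _)
            (Continuous.intervalIntegrable (by fun_prop) _ _) fun w _ => ?_
          have := haρ (φ n (w, τ))
          gcongr
  have h8 := intervalIntegral.integral_mono_on ht0
    (continuous_const.intervalIntegrable (μ := volume) 0 t)
    ((continuous_sliceIntegral (f := fun p => 2 * a (φ n p) * dx (φ n) p ^ 2)
      (by fun_prop)).intervalIntegrable 0 t) h3
  rw [intervalIntegral.integral_const, smul_eq_mul, sub_zero] at h8
  linarith

end IsApproxSolution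

/-! ### Approximation of a weak solution -/

/-- Smooth functions vanishing laterally that converge in `W^{2,1}_2` converge uniformly. -/
lemma exists_uniform_limit {T : ℝ} (hT : 0 < T) {y yx yxx yt : ℝ × ℝ → ℝ} {φ : ℕ → ℝ × ℝ → ℝ}
    (hy : IsW21 T y yx yxx yt) (hφ : ∀ n, ContDiff ℝ ∞ (φ n)) (hb : ∀ n, VanishesLaterally T (φ n))
    (h0 : Tendsto (fun n => eLpNorm (φ n - y) 2 (cylinderMeasure T)) atTop (𝓝 0))
    (hx : Tendsto (fun n => eLpNorm (dx (φ n) - yx) 2 (cylinderMeasure T)) atTop (𝓝 0))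
    (hxx : Tendsto (fun n => eLpNorm (dx (dx (φ n)) - yxx) 2 (cylinderMeasure T)) atTop (𝓝 0))
    (ht : Tendsto (fun n => eLpNorm (dt (φ n) - yt) 2 (cylinderMeasure T)) atTop (𝓝 0)) :
    ∃ (Y : ℝ × ℝ → ℝ) (e : ℕ → ℝ), Tendsto e atTop (𝓝 0) ∧
      (∀ n, ∀ p ∈ Icc (0 : ℝ) 1 ×ˢ Icc (0 : ℝ) T, |φ n p - Y p| ≤ e n) ∧
      ContinuousOn Y (Icc (0 : ℝ) 1 ×ˢ Icc (0 : ℝ) T) ∧ Y =ᵐ[cylinderMeasure T] y := by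
  set μ := cylinderMeasure T
  have mx : ∀ n, MemLp (dx (φ n)) 2 μ := fun n =>
    memLp_two_of_continuous (contDiff_dx (hφ n)).continuous T
  have mxx : ∀ n, MemLp (dx (dx (φ n))) 2 μ := fun n =>
    memLp_two_of_continuous (contDiff_dx (contDiff_dx (hφ n))).continuous T
  have mt : ∀ n, MemLp (dt (φ n)) 2 μ := fun n =>
    memLp_two_of_continuous (contDiff_dt (hφ n)).continuous T
  set d : ℕ → ℝ := fun n => (eLpNorm (dx (φ n) - yx) 2 μ).toReal
    + (eLpNorm (dx (dx (φ n)) - yxx) 2 μ).toReal + (eLpNorm (dt (φ n) - yt) 2 μ).toReal with hd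
  have hd0 : Tendsto d atTop (𝓝 0) := by
    have h := fun {u : ℕ → ℝ≥0∞} (hu : Tendsto u atTop (𝓝 0)) =>
      (ENNReal.tendsto_toReal ENNReal.zero_ne_top).comp hu
    simpa using ((h hx).add (h hxx)).add (h ht)
  -- In the sup bound for `φ n - φ m` each of the three `L²` norms is at most `d n + d m`; their
  -- weights are `T⁻¹`, `1` and `1`.
  set K := Real.sqrt (T⁻¹ + 2) with hK
  have hKsq : K ^ 2 = T⁻¹ + 2 := Real.sq_sqrt (by positivity)
  have hdn : ∀ n, 0 ≤ d n := fun n => by positivity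
  have key : ∀ n m, ∀ p ∈ Icc (0 : ℝ) 1 ×ˢ Icc (0 : ℝ) T,
      |φ n p - φ m p| ≤ K * (d n + d m) := by
    rintro n m ⟨x, t⟩ ⟨hxm, htm⟩
    have hs : ContDiff ℝ ∞ (φ n - φ m) := (hφ n).sub (hφ m)
    have hbd : VanishesLaterally T (φ n - φ m) := fun τ hτ => by
      simp [hb n τ hτ, hb m τ hτ]
    have hdif : ∀ n, Differentiable ℝ (φ n) := fun n => (hφ n).differentiable (by simp)
    have hdifx : ∀ n, Differentiable ℝ (dx (φ n)) := fun n =>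
      (contDiff_dx (hφ n)).differentiable (by simp)
    have h1 := sq_le_of_vanishesLaterally hT hs hbd hxm htm
    rw [dt_sub (hdif n) (hdif m), dx_sub (hdif n) (hdif m), dx_sub (hdifx n) (hdifx m),
      ← toReal_eLpNorm_two_sq ((mx n).sub (mx m)), ← toReal_eLpNorm_two_sq ((mxx n).sub (mxx m)),
      ← toReal_eLpNorm_two_sq ((mt n).sub (mt m))] at h1
    have pos : ∀ f : ℝ × ℝ → ℝ, 0 ≤ (eLpNorm f 2 μ).toReal := fun f => ENNReal.toReal_nonneg
    have b : ∀ r : ℝ, 0 ≤ r → r ≤ d n + d m → r ^ 2 ≤ (d n + d m) ^ 2 := fun r h0 h =>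
      pow_le_pow_left₀ h0 h 2
    have bx := b _ ENNReal.toReal_nonneg ((toReal_eLpNorm_sub_le (mx n) (mx m) hy.memLp_x).trans
      (by simp only [hd]; linarith [pos (dx (dx (φ n)) - yxx), pos (dx (dx (φ m)) - yxx),
        pos (dt (φ n) - yt), pos (dt (φ m) - yt)]))
    have bxx := b _ ENNReal.toReal_nonneg ((toReal_eLpNorm_sub_le (mxx n) (mxx m)
      hy.memLp_xx).trans
      (by simp only [hd]; linarith [pos (dx (φ n) - yx), pos (dx (φ m) - yx),
        pos (dt (φ n) - yt), pos (dt (φ m) - yt)]))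
    have bt := b _ ENNReal.toReal_nonneg ((toReal_eLpNorm_sub_le (mt n) (mt m) hy.memLp_t).trans
      (by simp only [hd]; linarith [pos (dx (dx (φ n)) - yxx), pos (dx (dx (φ m)) - yxx),
        pos (dx (φ n) - yx), pos (dx (φ m) - yx)]))
    have bx' := mul_le_mul_of_nonneg_left bx (inv_nonneg.2 hT.le)
    refine abs_le_of_sq_le_sq (a := φ n (x, t) - φ m (x, t)) ?_
      (mul_nonneg (Real.sqrt_nonneg _) (add_nonneg (hdn n) (hdn m)))
    rw [mul_pow, hKsq, add_mul]
    simp only [Pi.sub_apply] at h1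
    linarith
  have hlim : ∀ p ∈ Icc (0 : ℝ) 1 ×ˢ Icc (0 : ℝ) T, ∃ l, Tendsto (fun n => φ n p) atTop (𝓝 l) := by
    intro p hp
    refine cauchySeq_tendsto_of_complete (Metric.cauchySeq_iff'.2 fun ε hε => ?_)
    have h3 : Tendsto (fun n : ℕ × ℕ => K * (d n.1 + d n.2)) (atTop ×ˢ atTop) (𝓝 0) := by
      simpa using ((hd0.comp tendsto_fst).add (hd0.comp tendsto_snd)).const_mul K
    have h4 := h3.eventually_lt_const hε
    rw [prod_atTop_atTop_eq, eventually_atTop] at h4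
    obtain ⟨⟨N, N'⟩, hN⟩ := h4
    exact ⟨max N N', fun n hn => (key n _ p hp).trans_lt
      (hN (n, max N N') ⟨(le_max_left _ _).trans hn, le_max_right _ _⟩)⟩
  choose! Y hY using hlim
  have hbound : ∀ n, ∀ p ∈ Icc (0 : ℝ) 1 ×ˢ Icc (0 : ℝ) T, |φ n p - Y p| ≤ K * d n := by
    intro n p hp
    have h1 : Tendsto (fun m => |φ n p - φ m p|) atTop (𝓝 |φ n p - Y p|) :=
      (tendsto_const_nhds.sub (hY p hp)).abs
    have h2 : Tendsto (fun m => K * (d n + d m)) atTop (𝓝 (K * d n)) := by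
      simpa using (hd0.const_add (d n)).const_mul K
    exact le_of_tendsto_of_tendsto' h1 h2 fun m => key n m p hp
  have he : Tendsto (fun n => K * d n) atTop (𝓝 0) := by simpa using hd0.const_mul K
  refine ⟨Y, fun n => K * d n, he, hbound, ?_, ?_⟩
  · have hu : TendstoUniformlyOn φ Y atTop (Icc (0 : ℝ) 1 ×ˢ Icc (0 : ℝ) T) := by
      rw [Metric.tendstoUniformlyOn_iff]
      intro ε hε
      filter_upwards [he.eventually_lt_const hε] with n hn p hp
      rw [dist_comm]
      exact (hbound n p hp).trans_lt hn
    exact hu.continuousOn (Frequently.of_forall fun n => (hφ n).continuous.continuousOn)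
  · have hm := tendstoInMeasure_of_tendsto_eLpNorm (by norm_num)
      (fun n => (hφ n).continuous.aestronglyMeasurable) hy.memLp.1 h0
    obtain ⟨ns, hns, hae⟩ := hm.exists_seq_tendsto_ae
    filter_upwards [hae, ae_mem_cylinder T] with p hp hpc
    exact tendsto_nhds_unique ((hY p (cylinder_subset T hpc)).comp hns.tendsto_atTop) hp

/-- A solution is the limit of approximate solutions. -/
lemma IsSolution.exists_isApproxSolution {a : ℝ → ℝ} (ha : ContDiff ℝ 2 a) {M κ : ℝ}
    (ha1 : ∀ s, |deriv a s| ≤ M) (ha2 : ∀ s, |iteratedDeriv 2 a s| ≤ M)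
    (haκ : ∀ s, |a s| ≤ κ) {T : ℝ} (hT : 0 < T) {y₀ : ℝ → ℝ} {y : ℝ × ℝ → ℝ}
    (hy : IsSolution a T y₀ y) :
    ∃ φ e Y, IsApproxSolution a T φ e Y ∧ Y =ᵐ[cylinderMeasure T] y := by
  obtain ⟨yx, yxx, yt, ⟨hW, φ, hφ, hb, hlim⟩, heq, -⟩ := hy
  set μ := cylinderMeasure T with hμ
  have sq := fun {u : ℕ → ℝ≥0∞} (hu : ∀ n, u n ≤ _) =>
    tendsto_of_tendsto_of_tendsto_of_le_of_le tendsto_const_nhds hlim (fun _ => zero_le) hu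
  have h0 : Tendsto (fun n => eLpNorm (φ n - y) 2 μ) atTop (𝓝 0) :=
    sq fun n => le_self_add.trans (le_self_add.trans le_self_add)
  have hx : Tendsto (fun n => eLpNorm (dx (φ n) - yx) 2 μ) atTop (𝓝 0) :=
    sq fun n => le_add_self.trans (le_self_add.trans le_self_add)
  have hxx : Tendsto (fun n => eLpNorm (dx (dx (φ n)) - yxx) 2 μ) atTop (𝓝 0) :=
    sq fun n => le_add_self.trans le_self_add
  have ht : Tendsto (fun n => eLpNorm (dt (φ n) - yt) 2 μ) atTop (𝓝 0) :=
    sq fun n => le_add_self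
  obtain ⟨Y, e, he, hbound, hYc, hYy⟩ := exists_uniform_limit hT hW hφ hb h0 hx hxx ht
  refine ⟨φ, e, Y, ⟨hφ, hb, he, hbound, hYc, ?_⟩, hYy⟩
  have c0 : ∀ n, Continuous (φ n) := fun n => (hφ n).continuous
  have cx : ∀ n, Continuous (dx (φ n)) := fun n => (contDiff_dx (hφ n)).continuous
  have cxx : ∀ n, Continuous (dx (dx (φ n))) := fun n =>
    (contDiff_dx (contDiff_dx (hφ n))).continuous
  have ct : ∀ n, Continuous (dt (φ n)) := fun n => (contDiff_dt (hφ n)).continuous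
  have mx : ∀ n, MemLp (dx (φ n)) 2 μ := fun n => memLp_two_of_continuous (cx n) T
  have mxx : ∀ n, MemLp (dx (dx (φ n))) 2 μ := fun n => memLp_two_of_continuous (cxx n) T
  have mt : ∀ n, MemLp (dt (φ n)) 2 μ := fun n => memLp_two_of_continuous (ct n) T
  have ca : Continuous a := ha.continuous
  have ca' : Continuous (deriv a) := ha.continuous_deriv (by norm_num)
  have M0 : 0 ≤ M := (abs_nonneg _).trans (ha1 0)
  -- The bounds on `a'` and `a''` make `a` and `a'` Lipschitz, so both inherit uniform convergence
  -- along `φ n → Y = y`.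
  have lip : ∀ {f : ℝ → ℝ}, Differentiable ℝ f → (∀ s, |deriv f s| ≤ M) → ∀ n,
      ∀ᵐ p ∂μ, |f (φ n p) - f (y p)| ≤ M * e n := by
    intro f hf hf' n
    filter_upwards [hYy, ae_mem_cylinder T] with p hp hpc
    have h1 := Convex.norm_image_sub_le_of_norm_deriv_le (s := univ) (fun s _ => hf s)
      (fun s _ => hf' s) convex_univ (mem_univ (y p)) (mem_univ (φ n p))
    refine h1.trans (mul_le_mul_of_nonneg_left ?_ M0)
    rw [← hp]
    exact hbound n p (cylinder_subset T hpc)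
  have lipa := lip (ha.differentiable (by norm_num)) ha1
  have hda' : Differentiable ℝ (deriv a) := by
    have := ha.differentiable_iteratedDeriv 1 (by norm_num)
    rwa [iteratedDeriv_one] at this
  have lipa' := lip hda' (fun s => by
    have := ha2 s
    rwa [iteratedDeriv_succ, iteratedDeriv_one] at this)
  have hMe : Tendsto (fun n => M * e n) atTop (𝓝 0) := by simpa using he.const_mul M
  have ix : Integrable yx μ := hW.memLp_x.integrable (by norm_num)
  have ixx : Integrable yxx μ := hW.memLp_xx.integrable (by norm_num)
  have it : Integrable yt μ := hW.memLp_t.integrable (by norm_num)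
  have isq : Integrable (yx * yx) μ := hW.memLp_x.integrable_mul hW.memLp_x
  have lflux : Tendsto (fun n => eLpNorm ((fun p => a (φ n p)) * dx (φ n)
      - (fun p => a (y p)) * yx) 1 μ) atTop (𝓝 0) :=
    tendsto_eLpNorm_one_multiplier (fun n => (cx n).aestronglyMeasurable)
      (memLp_one_iff_integrable.2 ix) (fun n => ae_of_all _ fun p => haκ _) hMe lipa
      (tendsto_eLpNorm_one_of_two mx hW.memLp_x hx)
  -- The quadratic term `φ_x²` is controlled only in `L¹`; this is why the residual is measured
  -- there.
  have l1 : Tendsto (fun n => eLpNorm ((fun p => deriv a (φ n p)) * (dx (φ n) * dx (φ n))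
      - (fun p => deriv a (y p)) * (yx * yx)) 1 μ) atTop (𝓝 0) :=
    tendsto_eLpNorm_one_multiplier (fun n => ((cx n).mul (cx n)).aestronglyMeasurable)
      (memLp_one_iff_integrable.2 isq) (fun n => ae_of_all _ fun p => ha1 _) hMe lipa'
      (tendsto_eLpNorm_one_mul mx mx hW.memLp_x hW.memLp_x hx hx)
  have l2 : Tendsto (fun n => eLpNorm ((fun p => a (φ n p)) * dx (dx (φ n))
      - (fun p => a (y p)) * yxx) 1 μ) atTop (𝓝 0) :=
    tendsto_eLpNorm_one_multiplier (fun n => (cxx n).aestronglyMeasurable)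
      (memLp_one_iff_integrable.2 ixx) (fun n => ae_of_all _ fun p => haκ _) hMe lipa
      (tendsto_eLpNorm_one_of_two mxx hW.memLp_xx hxx)
  have ma : AEStronglyMeasurable (fun p => a (y p)) μ := ca.comp_aestronglyMeasurable hW.memLp.1
  have ma' : AEStronglyMeasurable (fun p => deriv a (y p)) μ :=
    ca'.comp_aestronglyMeasurable hW.memLp.1
  have iflux : Integrable ((fun p => a (y p)) * yx) μ :=
    ix.bdd_mul ma (ae_of_all _ fun p => haκ _)
  have i1 : Integrable ((fun p => deriv a (y p)) * (yx * yx)) μ :=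
    isq.bdd_mul ma' (ae_of_all _ fun p => ha1 _)
  have i2 : Integrable ((fun p => a (y p)) * yxx) μ :=
    ixx.bdd_mul ma (ae_of_all _ fun p => haκ _)
  have cf : ∀ n, Continuous (fluxDx a (φ n) (dx (φ n)) (dx (dx (φ n)))) := fun n =>
    continuous_fluxDx ha (hφ n)
  have lf : Tendsto (fun n => eLpNorm (fluxDx a (φ n) (dx (φ n)) (dx (dx (φ n)))
      - fluxDx a y yx yxx) 1 μ) atTop (𝓝 0) := by
    refine tendsto_eLpNorm_one_add (fun n => ?_) (fun n => ?_) l1 l2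
    · exact (((ca'.comp (c0 n)).mul ((cx n).mul (cx n))).aestronglyMeasurable).sub i1.1
    · exact (((ca.comp (c0 n)).mul (cxx n)).aestronglyMeasurable).sub i2.1
  -- The chain and product rules for the flux of `y` are inherited from the smooth case. By
  -- uniqueness of weak derivatives the equation then holds a.e. in expanded form.
  have hq : IsWeakDx T (fun p => a (y p) * yx p) (fluxDx a y yx yxx) :=
    IsWeakDx.of_tendsto (fun n => isWeakDx_flux T ha (hφ n))
      (fun n => integrable_of_continuous ((ca.comp (c0 n)).mul (cx n)) T) iflux
      (fun n => integrable_of_continuous (cf n) T) (i1.add i2) lflux lf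
  have hqt : fluxDx a y yx yxx =ᵐ[μ] yt := hq.unique heq (i1.add i2) it
  have lr : Tendsto (fun n => eLpNorm (residual a (φ n)) 1 μ) atTop (𝓝 0) := by
    refine tendsto_of_tendsto_of_tendsto_of_le_of_le tendsto_const_nhds
      (by simpa using (tendsto_eLpNorm_one_of_two mt hW.memLp_t ht).add lf)
      (fun _ => zero_le) fun n => ?_
    -- Subtracting the a.e. equation for `y` writes the residual as a difference of two errors that
    -- tend to `0` in `L¹`.
    have e1 : residual a (φ n) =ᵐ[μ] (dt (φ n) - yt)
        - (fluxDx a (φ n) (dx (φ n)) (dx (dx (φ n))) - fluxDx a y yx yxx) := by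
      filter_upwards [hqt] with p hp
      simp only [residual, Pi.sub_apply, hp]
      ring
    rw [eLpNorm_congr_ae e1]
    exact eLpNorm_sub_le ((mt n).1.sub it.1)
      ((cf n).aestronglyMeasurable.sub (i1.add i2).1) le_rfl
  refine ((ENNReal.tendsto_toReal ENNReal.zero_ne_top).comp lr).congr fun n => ?_
  simp only [Function.comp, eLpNorm_one_eq_lintegral_enorm]
  exact (integral_norm_eq_lintegral_enorm (continuous_residual ha (hφ n)).aestronglyMeasurable).symm

/-! ### Initial value and conclusion -/

instance : IsProbabilityMeasure intervalMeasure := by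
  constructor
  rw [intervalMeasure, Measure.restrict_apply_univ]
  simp

/-- Every interval `(0, u)` has positive measure. Without this an essential limit at `0+` would
carry no information. -/
lemma neBot_nhdsGT_inf_ae : NeBot (𝓝[>] (0 : ℝ) ⊓ ae volume) := by
  rw [inf_neBot_iff]
  intro s hs s' hs'
  obtain ⟨u, hu, hus⟩ := (mem_nhdsGT_iff_exists_Ioo_subset).1 hs
  by_contra hne
  have h1 : Ioo 0 u ⊆ s'ᶜ := fun x hx hx' => hne ⟨x, hus hx, hx'⟩
  have h2 := measure_mono_null h1 (mem_ae_iff.1 hs')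
  rw [Real.volume_Ioo, ENNReal.ofReal_eq_zero, sub_zero] at h2
  exact absurd h2 (not_le.2 hu)

/-- A continuous representative attains the initial value. -/
lemma HasInitialValue.ae_eq {T : ℝ} (hT : 0 < T) {y Y : ℝ × ℝ → ℝ} {y₀ : ℝ → ℝ}
    (h : HasInitialValue y y₀) (hy₀ : AEStronglyMeasurable y₀ intervalMeasure)
    (hY : ContinuousOn Y (Icc (0 : ℝ) 1 ×ˢ Icc (0 : ℝ) T)) (hYy : Y =ᵐ[cylinderMeasure T] y) :
    (fun x => Y (x, 0)) =ᵐ[intervalMeasure] y₀ := by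
  have := neBot_nhdsGT_inf_ae
  have hmeas : ∀ t ∈ Icc 0 T, AEStronglyMeasurable (fun x => Y (x, t)) intervalMeasure := by
    intro t ht
    exact ContinuousOn.aestronglyMeasurable (hY.comp (by fun_prop)
      fun x hx => ⟨Ioo_subset_Icc_self hx, ht⟩) measurableSet_Ioo
  have hslice : ∀ᵐ t ∂volume.restrict (Ioo 0 T), ∀ᵐ x ∂intervalMeasure, Y (x, t) = y (x, t) := by
    have e : cylinderMeasure T = intervalMeasure.prod (volume.restrict (Ioo 0 T)) := by
      rw [cylinderMeasure, intervalMeasure, Measure.prod_restrict]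
      rfl
    rw [e] at hYy
    exact Measure.ae_ae_of_ae_prod
      (Measure.measurePreserving_swap.quasiMeasurePreserving.ae hYy)
  rw [ae_restrict_iff' measurableSet_Ioo] at hslice
  have hIoo : Ioo 0 T ∈ 𝓝[>] (0 : ℝ) := Ioo_mem_nhdsGT hT
  have hε : ∀ ε : ℝ, 0 < ε →
      eLpNorm (fun x => Y (x, 0) - y₀ x) 2 intervalMeasure ≤ ENNReal.ofReal ε := by
    intro ε hε
    -- Uniform continuity brings `Y(·, 0)` within `ε` of `Y(·, t)` for small `t`. For almost every
    -- such `t` the latter equals `y(·, t)` a.e., so the essential limit applies.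
    obtain ⟨δ, hδ, hδY⟩ := Metric.uniformContinuousOn_iff_le.1
      ((isCompact_Icc.prod isCompact_Icc).uniformContinuousOn_of_continuous hY) ε hε
    have hlim := h.const_add (ENNReal.ofReal ε)
    rw [add_zero] at hlim
    refine ge_of_tendsto hlim ?_
    have hδm : Ioo 0 δ ∈ 𝓝[>] (0 : ℝ) := Ioo_mem_nhdsGT hδ
    filter_upwards [mem_inf_of_left hIoo, mem_inf_of_left hδm, mem_inf_of_right hslice]
      with t ht htδ hst
    have htT : t ∈ Icc 0 T := Ioo_subset_Icc_self ht
    have h0T : (0 : ℝ) ∈ Icc 0 T := ⟨le_rfl, hT.le⟩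
    have e1 : eLpNorm (fun x => y (x, t) - y₀ x) 2 intervalMeasure
        = eLpNorm (fun x => Y (x, t) - y₀ x) 2 intervalMeasure := by
      refine eLpNorm_congr_ae ?_
      filter_upwards [hst ht] with x hx
      rw [hx]
    have e2 : eLpNorm (fun x => Y (x, 0) - Y (x, t)) 2 intervalMeasure ≤ ENNReal.ofReal ε := by
      have hbd : ∀ᵐ x ∂intervalMeasure, ‖Y (x, 0) - Y (x, t)‖ ≤ ε := by
        filter_upwards [ae_restrict_mem measurableSet_Ioo] with x hx
        have hx' := Ioo_subset_Icc_self hx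
        refine hδY (x, 0) ⟨hx', h0T⟩ (x, t) ⟨hx', htT⟩ ?_
        rw [Prod.dist_eq]
        simp only [dist_self, dist_zero_left, Real.norm_eq_abs, abs_of_pos ht.1]
        exact max_le hδ.le htδ.2.le
      -- The interval has mass one, so a sup bound is an `L²` bound with the same constant.
      simpa using eLpNorm_le_of_ae_bound (p := 2) hbd
    rw [e1]
    have e3 : (fun x => Y (x, 0) - y₀ x)
        = (fun x => Y (x, 0) - Y (x, t)) + fun x => Y (x, t) - y₀ x := by
      ext x; simp
    rw [e3]
    exact (eLpNorm_add_le ((hmeas 0 h0T).sub (hmeas t htT)) ((hmeas t htT).sub hy₀)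
      (by norm_num)).trans (add_le_add_left e2 _)
  have hz : eLpNorm (fun x => Y (x, 0) - y₀ x) 2 intervalMeasure = 0 := by
    have ht : Tendsto ENNReal.ofReal (𝓝[>] 0) (𝓝 0) := by
      simpa using (ENNReal.continuous_ofReal.tendsto 0).mono_left nhdsWithin_le_nhds
    refine le_antisymm (ge_of_tendsto ht ?_) zero_le
    filter_upwards [self_mem_nhdsWithin] with ε hε' using hε ε hε'
  have hz' := (eLpNorm_eq_zero_iff ((hmeas 0 ⟨le_rfl, hT.le⟩).sub hy₀) (by norm_num)).1 hz
  filter_upwards [hz'] with x hx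
  exact sub_eq_zero.1 hx

lemma abs_le_rpow_of_mul_sq_le {c t v N : ℝ} (hc : 0 < c) (ht : 0 < t) (hN : 0 ≤ N)
    (h : c * t * v ^ 2 ≤ N ^ 2) :
    |v| ≤ c ^ (-(1 / 2) : ℝ) * N * t ^ (-(1 / 2) : ℝ) := by
  have hs : ∀ s : ℝ, 0 < s → s * (s ^ (-(1 / 2) : ℝ)) ^ 2 = 1 := fun s hs => by
    rw [← Real.rpow_natCast, ← Real.rpow_mul hs.le]
    norm_num
    rw [Real.rpow_neg_one, mul_inv_cancel₀ hs.ne']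
  refine abs_le_of_sq_le_sq (le_of_mul_le_mul_left ?_ (mul_pos hc ht)) (by positivity)
  refine h.trans (le_of_eq ?_)
  linear_combination (-N ^ 2) * (t * (t ^ (-(1 / 2) : ℝ)) ^ 2 * hs c hc + hs t ht)

end QuasilinearParabolic

theorem proposition2p1
    (a : ℝ → ℝ) (ha : ContDiff ℝ 2 a)
    (M : ℝ) (hM : 0 < M)
    (ha1 : ∀ s, |deriv a s| ≤ M) (ha2 : ∀ s, |iteratedDeriv 2 a s| ≤ M)
    (ρ κ : ℝ) (hρ : 0 < ρ) (ha3 : ∀ s, ρ ≤ a s ∧ a s ≤ κ)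
    (T : ℝ) (hT : 0 < T)
    (y₀ : ℝ → ℝ) (hy₀ : QuasilinearParabolic.MemH10 y₀)
    (y : ℝ × ℝ → ℝ) (hy : QuasilinearParabolic.IsSolution a T y₀ y) :
    ∃ Y : ℝ × ℝ → ℝ,
      ContinuousOn Y (Icc (0 : ℝ) 1 ×ˢ Icc (0 : ℝ) T) ∧
      Y =ᵐ[QuasilinearParabolic.cylinderMeasure T] y ∧
      ∀ t ∈ Ioc (0 : ℝ) T, ∀ x ∈ Icc (0 : ℝ) 1,
        |Y (x, t)| ≤ (2 * ρ) ^ (-(1 / 2) : ℝ)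
          * (eLpNorm y₀ 2 QuasilinearParabolic.intervalMeasure).toReal
          * t ^ (-(1 / 2) : ℝ) := by
  obtain ⟨φ, e, Y, hA, hYy⟩ := hy.exists_isApproxSolution ha ha1 ha2
    (fun s => abs_le.2 ⟨by linarith [ha3 s], (ha3 s).2⟩) hT
  refine ⟨Y, hA.continuousOn, hYy, fun t ht x hx => ?_⟩
  obtain ⟨-, hL, -⟩ := hy₀
  obtain ⟨-, -, -, -, -, hinit⟩ := hy
  have hY0 := hinit.ae_eq hT hL.1 hA.continuousOn hYy
  refine QuasilinearParabolic.abs_le_rpow_of_mul_sq_le (by positivity) ht.1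
    ENNReal.toReal_nonneg ?_
  rw [QuasilinearParabolic.toReal_eLpNorm_two_sq hL]
  refine (hA.mul_sq_le ha hρ (fun u => (ha3 u).1) hx ht).trans (le_of_eq ?_)
  rw [intervalIntegral.integral_of_le zero_le_one, integral_Ioc_eq_integral_Ioo]
  refine integral_congr_ae ?_
  filter_upwards [hY0] with z hz
  rw [hz]
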